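/- Let $k$ be a commutative ring and let $\mathcal{A}=(A=\bigoplus_{i\in\mathbb{Z}}A^i,d)$ be a differential graded $k$-algebra (associative, unital) such that $A^i=0$ for $i<0$, the ring $A^0$ is semisimple, and $d(A^0)=0$. Let $\mathrm{dgHot}(\mathcal{A})$ be the homotopy category of dg right $\mathcal{A}$-modules, with its triangulated structure in which the shift $\{1\}$ is given by $(\{1\}M)^i=M^{i+1}$, $d_{\{1\}M}=-d_M$, and the distinguished triangles are those isomorphic to mapping cone triangles. Let $\mathrm{dgPer}(\mathcal{A})$ be the smallest full triangulated subcategory of $\mathrm{dgHot}(\mathcal{A})$ that contains $\mathcal{A}$ and is closed under direct summands. For a dg module $M$ put $\overline{M}=M/MA^+$, where $A^+=\bigoplus_{i>0}A^i$. Let $\heartsuit$ be the full subcategory of $\mathrm{dgPer}(\mathcal{A})$ consisting of the objects $M$ with $H^i(\overline{M})=0$ for all $i\neq 0$ (the heart of the t-structure whose aisles $\mathrm{dgPer}^{\le 0}$ and $\mathrm{dgPer}^{\ge 0}$ consist of the $M$ with $H^i(\overline{M})=0$ for $i>0$, respectively for $i<0$). Then an object $M$ of $\heartsuit$ is injective in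 $\heartsuit$ if and only if $H^1(M)=0$. -/

import Mathlib

open CategoryTheory MulOpposite

universe w u

namespace PerfectDG

/-- A structure of differential graded `k`-algebra `(A = ⨁_{i ∈ ℤ} Aⁱ, d)` on a `k`-algebra `A`. -/
structure DGAlgebra (k : Type w) [CommRing k] (A : Type u) [Ring A] [Algebra k A] where
  /-- the homogeneous components `Aⁱ` -/
  gr : ℤ → Submodule k A
  [graded : GradedAlgebra gr]
  /-- the differential -/
  d : A →ₗ[k] A
  d_mem : ∀ (i : ℤ), ∀ a ∈ gr i, d a ∈ gr (i + 1)
  d_d : ∀ a, d (d a) = 0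
  d_mul : ∀ (i : ℤ), ∀ a ∈ gr i, ∀ b, d (a * b) = d a * b + i.negOnePow • (a * d b)

attribute [instance] DGAlgebra.graded

/-- The `i`-th cohomology group `(Vⁱ ∩ ker d) / d(Vⁱ⁻¹)` of an abelian group `V` with a family
of subgroups `Vⁱ` and an additive map `d`. -/
abbrev gradedCohomology {V : Type u} [AddCommGroup V] (gr : ℤ → AddSubgroup V) (d : V →+ V)
    (i : ℤ) : Type u :=
  ↥(gr i ⊓ d.ker) ⧸ ((gr (i - 1)).map d).addSubgroupOf (gr i ⊓ d.ker)

variable {k : Type w} [CommRing k] {A : Type u} [Ring A] [Algebra k A]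

/-- A dg right module over the dg algebra `𝓐`. Right multiplication `m a` is written `op a • m`.
The `k`-module structure is the one induced by `k → A`; since the image of `k` lies in
`A⁰ ∩ ker d`, the components are automatically `k`-submodules and `d` is `k`-linear. -/
structure DGModule (𝓐 : DGAlgebra k A) where
  carrier : Type u
  [addCommGroup : AddCommGroup carrier]
  [module : Module Aᵐᵒᵖ carrier]
  /-- the homogeneous components `Mⁱ`; the next two fields say that `M = ⨁_{i ∈ ℤ} Mⁱ` -/
  gr : ℤ → AddSubgroup carrier
  gr_indep : iSupIndep gr
  gr_iSup : ⨆ i, gr i = ⊤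
  smul_mem : ∀ (i j : ℤ), ∀ m ∈ gr i, ∀ a ∈ 𝓐.gr j, op a • m ∈ gr (i + j)
  /-- the differential -/
  d : carrier →+ carrier
  d_mem : ∀ (i : ℤ), ∀ m ∈ gr i, d m ∈ gr (i + 1)
  d_d : ∀ m, d (d m) = 0
  d_smul : ∀ (i : ℤ), ∀ m ∈ gr i, ∀ a,
    d (op a • m) = op a • d m + i.negOnePow • (op (𝓐.d a) • m)

attribute [instance] DGModule.addCommGroup DGModule.module

namespace DGModule

variable {𝓐 : DGAlgebra k A}

/-- Morphisms of dg modules: `A`-linear maps of degree zero commuting with the differentials. -/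
@[ext]
structure Hom (M N : DGModule 𝓐) where
  toLin : M.carrier →ₗ[Aᵐᵒᵖ] N.carrier
  map_mem : ∀ (i : ℤ), ∀ m ∈ M.gr i, toLin m ∈ N.gr i
  map_d : ∀ m, toLin (M.d m) = N.d (toLin m)

/-- The category `dgMod(𝓐)`. -/
instance : Category (DGModule 𝓐) where
  Hom := Hom
  id M := ⟨LinearMap.id, fun _ _ h => h, fun _ => rfl⟩
  comp f g := ⟨g.toLin.comp f.toLin, fun i m h => g.map_mem i _ (f.map_mem i m h),
    fun m => by simp [f.map_d, g.map_d]⟩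

/-- `f` and `g` are homotopic: `f - g = d h + h d` for a homogeneous `A`-linear map `h`
of degree `-1`. -/
def Homotopic : HomRel (DGModule 𝓐) := fun M N f g =>
  ∃ h : M.carrier →ₗ[Aᵐᵒᵖ] N.carrier, (∀ (i : ℤ), ∀ m ∈ M.gr i, h m ∈ N.gr (i - 1)) ∧
    ∀ m, Hom.toLin f m - Hom.toLin g m = N.d (h m) + h (M.d m)

/-- Homotopy is an equivalence relation compatible with composition, so that morphisms in the
quotient category below are exactly homotopy classes. -/
instance : Congruence (Homotopic (𝓐 := 𝓐)) where
  equivalence :=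
    { refl := fun f => ⟨0, fun i m _ => by simp, fun m => by simp⟩
      symm := fun {f g} ⟨h, h1, h2⟩ => ⟨-h, fun i m hm => by simpa using h1 i m hm, fun m => by
        have := h2 m
        simp only [LinearMap.neg_apply, map_neg]
        rw [← neg_sub, this]; abel⟩
      trans := fun {f g e} ⟨h, h1, h2⟩ ⟨h', h1', h2'⟩ =>
        ⟨h + h', fun i m hm => by simpa using add_mem (h1 i m hm) (h1' i m hm), fun m => by
          simp only [LinearMap.add_apply, map_add]
          rw [← sub_add_sub_cancel _ (Hom.toLin g m), h2, h2']; abel⟩ }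
  comp_left := fun {X Y Z} f {g g'} ⟨h, h1, h2⟩ =>
    ⟨h.comp (Hom.toLin f), fun i m hm => h1 i _ (Hom.map_mem f i m hm), fun m => by
      have := h2 (Hom.toLin f m)
      rw [← Hom.map_d f] at this
      exact this⟩
  comp_right := fun {X Y Z f f'} g ⟨h, h1, h2⟩ =>
    ⟨(Hom.toLin g).comp h, fun i m hm => Hom.map_mem g _ _ (h1 i m hm), fun m => by
      have := congrArg (Hom.toLin g) (h2 m)
      rw [map_sub, map_add, Hom.map_d g] at this
      exact this⟩

/-- `𝓐` as a dg right module over itself. -/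
def regular (𝓐 : DGAlgebra k A) : DGModule 𝓐 where
  carrier := A
  gr i := (𝓐.gr i).toAddSubgroup
  gr_indep := by
    have h := (DirectSum.Decomposition.isInternal 𝓐.gr).submodule_iSupIndep
    intro i
    rw [disjoint_iff_inf_le]
    intro x ⟨hx1, hx2⟩
    have key : (⨆ (j) (_ : j ≠ i), (𝓐.gr j).toAddSubgroup) ≤
        (⨆ (j) (_ : j ≠ i), 𝓐.gr j).toAddSubgroup :=
      iSup₂_le fun j hj => (le_iSup₂ (f := fun j (_ : j ≠ i) => 𝓐.gr j) j hj :)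
    exact Submodule.disjoint_def.mp (h i) x hx1 (key hx2)
  gr_iSup := by
    rw [eq_top_iff]
    intro x _
    classical
    rw [← DirectSum.sum_support_decompose 𝓐.gr x]
    exact sum_mem fun i _ =>
      (le_iSup (fun i => (𝓐.gr i).toAddSubgroup) i) (DirectSum.decompose 𝓐.gr x i).2
  smul_mem i j m hm a ha := SetLike.mul_mem_graded (A := 𝓐.gr) hm ha
  d := 𝓐.d.toAddMonoidHom
  d_mem := 𝓐.d_mem
  d_d := 𝓐.d_d
  d_smul := 𝓐.d_mul

/-- The shift `{n}M`: `({n}M)ⁱ = Mⁱ⁺ⁿ`, with differential `(-1)ⁿ d` and the same action of `A`. -/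
def shift (M : DGModule 𝓐) (n : ℤ) : DGModule 𝓐 where
  carrier := M.carrier
  gr i := M.gr (i + n)
  gr_indep := M.gr_indep.comp (add_left_injective n)
  gr_iSup := by
    rw [← M.gr_iSup]
    exact (Equiv.addRight n).iSup_comp (g := M.gr)
  smul_mem i j m hm a ha := by
    have := M.smul_mem _ j m hm a ha
    rwa [show i + j + n = i + n + j by ring]
  d := n.negOnePow • M.d
  d_mem i m hm := by
    have := M.d_mem _ m hm
    rw [show i + 1 + n = i + n + 1 by ring]
    rcases Int.units_eq_one_or n.negOnePow with h | h <;> rw [h] <;> simpa using this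
  d_d m := by
    rcases Int.units_eq_one_or n.negOnePow with h | h <;> rw [h] <;> simp [M.d_d]
  d_smul i m hm a := by
    have := M.d_smul _ m hm a
    rw [Int.negOnePow_add] at this
    rcases Int.units_eq_one_or n.negOnePow with h | h <;> rw [h] at this ⊢ <;>
      simp [this, add_comm]

/-- The mapping cone `N ⊕ {1}M` of a morphism `f : M ⟶ N`, with differential
`(n, m) ↦ (d n + f m, - d m)`. -/
def cone {M N : DGModule 𝓐} (f : M ⟶ N) : DGModule 𝓐 where
  carrier := N.carrier × M.carrier
  gr i := (N.gr i).prod (M.gr (i + 1))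
  gr_indep := by
    intro i
    rw [disjoint_iff_inf_le]
    intro x ⟨hx1, hx2⟩
    have h1 : x.1 ∈ ⨆ (j) (_ : j ≠ i), N.gr j := by
      have key : (⨆ (j) (_ : j ≠ i), (N.gr j).prod (M.gr (j + 1))) ≤
          (⨆ (j) (_ : j ≠ i), N.gr j).comap (AddMonoidHom.fst _ _) :=
        iSup₂_le fun j hj y hy => (le_iSup₂ (f := fun j (_ : j ≠ i) => N.gr j) j hj :) hy.1
      exact key hx2
    have h2 : x.2 ∈ ⨆ (j) (_ : j ≠ i + 1), M.gr j := by
      have key : (⨆ (j) (_ : j ≠ i), (N.gr j).prod (M.gr (j + 1))) ≤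
          (⨆ (j) (_ : j ≠ i + 1), M.gr j).comap (AddMonoidHom.snd _ _) :=
        iSup₂_le fun j hj y hy =>
          (le_iSup₂ (f := fun j (_ : j ≠ i + 1) => M.gr j) (j + 1) (by omega) :) hy.2
      exact key hx2
    exact Prod.ext (AddSubgroup.disjoint_def.mp (N.gr_indep i) hx1.1 h1)
      (AddSubgroup.disjoint_def.mp (M.gr_indep (i + 1)) hx1.2 h2)
  gr_iSup := by
    rw [eq_top_iff]
    intro x _
    have h1 : (⊤ : AddSubgroup N.carrier) ≤
        (⨆ i, (N.gr i).prod (M.gr (i + 1))).comap (AddMonoidHom.inl _ _) := by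
      rw [← N.gr_iSup]
      exact iSup_le fun i y hy =>
        (le_iSup (fun i => (N.gr i).prod (M.gr (i + 1))) i) ⟨hy, zero_mem _⟩
    have h2 : (⊤ : AddSubgroup M.carrier) ≤
        (⨆ i, (N.gr i).prod (M.gr (i + 1))).comap (AddMonoidHom.inr _ _) := by
      rw [← M.gr_iSup]
      exact iSup_le fun i y hy =>
        (le_iSup (fun i => (N.gr i).prod (M.gr (i + 1))) (i - 1))
          ⟨zero_mem _, by simpa using hy⟩
    rw [show x = AddMonoidHom.inl _ _ x.1 + AddMonoidHom.inr _ _ x.2 by simp]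
    exact add_mem (h1 (AddSubgroup.mem_top x.1)) (h2 (AddSubgroup.mem_top x.2))
  smul_mem i j m hm a ha := ⟨N.smul_mem _ _ _ hm.1 _ ha, by
    have := M.smul_mem _ _ _ hm.2 _ ha
    rwa [show i + 1 + j = i + j + 1 by ring] at this⟩
  d := (N.d.comp (AddMonoidHom.fst _ _) +
      (Hom.toLin f).toAddMonoidHom.comp (AddMonoidHom.snd _ _)).prod
    (-(M.d.comp (AddMonoidHom.snd _ _)))
  d_mem i m hm := ⟨by simpa using add_mem (N.d_mem _ _ hm.1) (Hom.map_mem f _ _ hm.2),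
    by simpa using M.d_mem _ _ hm.2⟩
  d_d m := by
    ext <;> simp [N.d_d, M.d_d, Hom.map_d f]
  d_smul i m hm a := by
    have h1 := N.d_smul _ _ hm.1 a
    have h2 := M.d_smul _ _ hm.2 a
    rw [Int.negOnePow_succ] at h2
    refine Prod.ext ?_ ?_
    · simp [h1]; abel
    · simp [h2]; abel

/-- The cohomology `Hⁱ(M)`. -/
abbrev cohomology (M : DGModule 𝓐) (i : ℤ) : Type u := gradedCohomology M.gr M.d i

/-- `M A⁺`, where `A⁺ = ⨁_{j > 0} Aʲ`: the subgroup generated by all products `m a` of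
homogeneous elements with `a` of positive degree. -/
def mulAugmentation (M : DGModule 𝓐) : AddSubgroup M.carrier :=
  AddSubgroup.closure {x | ∃ (i j : ℤ) (m : M.carrier) (a : A),
    m ∈ M.gr i ∧ 0 < j ∧ a ∈ 𝓐.gr j ∧ x = op a • m}

lemma d_mem_mulAugmentation (M : DGModule 𝓐) :
    M.mulAugmentation ≤ M.mulAugmentation.comap M.d := by
  refine (AddSubgroup.closure_le _).mpr ?_
  rintro _ ⟨i, j, m, a, hm, hj, ha, rfl⟩
  have h1 : op a • M.d m ∈ M.mulAugmentation :=
    AddSubgroup.subset_closure ⟨_, j, _, a, M.d_mem i m hm, hj, ha, rfl⟩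
  have h2 : op (𝓐.d a) • m ∈ M.mulAugmentation :=
    AddSubgroup.subset_closure ⟨i, j + 1, m, _, hm, by omega, 𝓐.d_mem j a ha, rfl⟩
  change M.d (op a • m) ∈ M.mulAugmentation
  rw [M.d_smul i m hm a]
  rcases Int.units_eq_one_or i.negOnePow with h | h <;> rw [h]
  · simpa using add_mem h1 h2
  · simpa using add_mem h1 (neg_mem h2)

/-- The underlying abelian group of `M̄ = M / M A⁺ = M ⊗_𝓐 𝓐⁰`. -/
abbrev Bar (M : DGModule 𝓐) : Type u := M.carrier ⧸ M.mulAugmentation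

/-- The homogeneous components of `M̄`. -/
def barGr (M : DGModule 𝓐) (i : ℤ) : AddSubgroup M.Bar :=
  (M.gr i).map (QuotientAddGroup.mk' M.mulAugmentation)

/-- The differential of `M̄`. -/
def barD (M : DGModule 𝓐) : M.Bar →+ M.Bar :=
  QuotientAddGroup.map _ _ M.d M.d_mem_mulAugmentation

/-- The support of `H(M̄)`: the set of all `i` with `Hⁱ(M̄) ≠ 0`. -/
def barSupport (M : DGModule 𝓐) : Set ℤ :=
  {i | Nontrivial (gradedCohomology M.barGr M.barD i)}

end DGModule

/-- The homotopy category `dgHot(𝓐)` of dg modules. -/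
abbrev DGHot (𝓐 : DGAlgebra k A) := Quotient (DGModule.Homotopic (𝓐 := 𝓐))

/-- The image in `dgHot(𝓐)` of a dg module. -/
abbrev toHot {𝓐 : DGAlgebra k A} (M : DGModule 𝓐) : DGHot 𝓐 :=
  (Quotient.functor (DGModule.Homotopic (𝓐 := 𝓐))).obj M

/-- The objects of `dgPer(𝓐)`: the smallest full subcategory of `dgHot(𝓐)` which contains `𝓐`,
is triangulated (stable under shifts and mapping cones, the distinguished triangles being those
isomorphic to a mapping cone triangle) and stable under direct summands. In a triangulated
category direct summands are the same as retracts; stability under retracts includes stability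
under isomorphisms. -/
inductive IsPerfect (𝓐 : DGAlgebra k A) : ObjectProperty (DGHot 𝓐)
  | regular : IsPerfect 𝓐 (toHot (DGModule.regular 𝓐))
  | shift (M : DGModule 𝓐) (n : ℤ) : IsPerfect 𝓐 (toHot M) → IsPerfect 𝓐 (toHot (M.shift n))
  | cone {M N : DGModule 𝓐} (f : M ⟶ N) : IsPerfect 𝓐 (toHot M) → IsPerfect 𝓐 (toHot N) →
      IsPerfect 𝓐 (toHot (DGModule.cone f))
  | retract {X Y : DGHot 𝓐} (r : Retract X Y) : IsPerfect 𝓐 Y → IsPerfect 𝓐 X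

/-- `dgPer^I`: the perfect dg modules `M` such that `H(M̄)` is supported in `I ⊆ ℤ`. -/
def perfectSupportedIn (𝓐 : DGAlgebra k A) (I : Set ℤ) : ObjectProperty (DGHot 𝓐) :=
  fun X => IsPerfect 𝓐 X ∧ X.as.barSupport ⊆ I

/-- The heart `♥ = dgPer⁰ = dgPer^{≤ 0} ∩ dgPer^{≥ 0}`, a full subcategory of `dgHot(𝓐)`. -/
abbrev Heart (𝓐 : DGAlgebra k A) := (perfectSupportedIn 𝓐 {0}).FullSubcategory

end PerfectDG

/-! A cocycle `z` of degree one in `M` is a map `{-1}𝓐 → M`, and its cone is an extension of `𝓐` by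
`M` inside `♥`. The inclusion of `M` in this cone is a monomorphism of `♥`, for degree reasons. If
`M` is injective it therefore splits, and a splitting exhibits `z` as a boundary
(`subsingleton_cohomology_of_injective`).

Conversely, let `f : X → Y` be a monomorphism of `♥` and `g : X → M`. Then `g` extends along `f` as
soon as `cone f → {1}X → {1}M` is null-homotopic. Objects of `♥` are retracts of modules with a
finite basis in degree zero (`exists_cellBasis_deg_zero`), so the cone can be replaced by a minimal
model with basis in degrees `-1` and `0`. Its part of degree `-1`, shifted, is an object `K` of `♥`
with a map `K → X` whose composite with `f` is zero; hence `K → X` is zero. What is left vanishes on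
the generators of degree `-1`, and killing it on the generators of degree `0`, one at a time, meets
only obstructions in `H¹(M)` (`homotopic_zeroHom_of_cohomology`).

The tool is `CellBasis`: a finite triangular basis whose elements are attached to primitive
idempotents of `A⁰`. Semisimplicity gives one on `𝓐`, and shifts and cones inherit it. By Schur's
lemma the nonzero entries in `A⁰` of the matrix of `d` are invertible, so Gaussian elimination
removes them (`exists_elimination`). Then `M̄` has zero differential, and an endomorphism that
factors through `♥` lowers the degree filtration away from degree zero (`IsMinimal.map_mem_filt`);
iterating it confines a retract to degree zero. -/

namespace PerfectDG

variable {k : Type w} [CommRing k] {A : Type u} [Ring A] [Algebra k A]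

/-! ### Homotopies, homotopy retracts, shifts and cones. -/

namespace DGModule

variable {𝓐 : DGAlgebra k A}

/-- Induction on homogeneous elements. -/
lemma homogeneous_induction (M : DGModule 𝓐) {P : M.carrier → Prop} (zero : P 0)
    (add : ∀ x y, P x → P y → P (x + y)) (mem : ∀ i, ∀ x ∈ M.gr i, P x) (x : M.carrier) : P x := by
  have hx : x ∈ ⨆ i, M.gr i := by rw [M.gr_iSup]; trivial
  exact AddSubgroup.iSup_induction M.gr (C := P) hx mem zero add

/-- The map `h ↦ d h + h d` from linear maps of degree `-1` to morphisms. -/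
def nullHom {M N : DGModule 𝓐} (h : M.carrier →ₗ[Aᵐᵒᵖ] N.carrier)
    (hh : ∀ i, ∀ m ∈ M.gr i, h m ∈ N.gr (i - 1)) : M ⟶ N where
  toLin :=
    { toFun := fun m => N.d (h m) + h (M.d m)
      map_add' := fun x y => by simp only [map_add]; abel
      map_smul' := fun r x => by
        obtain ⟨a, rfl⟩ := op_surjective r
        refine M.homogeneous_induction (P := fun x => N.d (h (op a • x)) + h (M.d (op a • x)) =
          op a • (N.d (h x) + h (M.d x))) (by simp) (fun x y hx hy => ?_) (fun i x hx => ?_) x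
        · simp only [smul_add, map_add] at hx hy ⊢
          rw [add_add_add_comm, hx, hy]
          abel
        -- Since `h x` has degree `i - 1`, the two terms containing `d a` carry opposite signs and
        -- cancel.
        · rw [map_smul, M.d_smul i x hx, N.d_smul _ _ (hh i x hx), Int.negOnePow_sub,
            Int.negOnePow_one]
          rcases Int.units_eq_one_or i.negOnePow with h | h <;> rw [h] <;> simp <;> abel }
  map_mem i m hm := by
    have h1 := N.d_mem _ _ (hh i m hm)
    have h2 := hh _ _ (M.d_mem i m hm)
    rw [sub_add_cancel] at h1
    rw [add_sub_cancel_right] at h2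
    exact add_mem h1 h2
  map_d m := by simp [N.d_d, M.d_d]

@[simp] lemma nullHom_apply {M N : DGModule 𝓐} (h : M.carrier →ₗ[Aᵐᵒᵖ] N.carrier)
    (hh : ∀ i, ∀ m ∈ M.gr i, h m ∈ N.gr (i - 1)) (m : M.carrier) :
    Hom.toLin (nullHom h hh) m = N.d (h m) + h (M.d m) := rfl

@[simp] lemma comp_toLin {M N P : DGModule 𝓐} (f : M ⟶ N) (g : N ⟶ P) (m : M.carrier) :
    Hom.toLin (f ≫ g) m = Hom.toLin g (Hom.toLin f m) := rfl

@[simp] lemma id_toLin {M : DGModule 𝓐} (m : M.carrier) :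
    Hom.toLin (𝟙 M) m = m := rfl

/-- The difference of two morphisms. -/
def subHom {M N : DGModule 𝓐} (f g : M ⟶ N) : M ⟶ N where
  toLin := Hom.toLin f - Hom.toLin g
  map_mem i m hm := sub_mem (Hom.map_mem f i m hm) (Hom.map_mem g i m hm)
  map_d m := by simp [Hom.map_d]

@[simp] lemma subHom_apply {M N : DGModule 𝓐} (f g : M ⟶ N) (m : M.carrier) :
    Hom.toLin (subHom f g) m = Hom.toLin f m - Hom.toLin g m := rfl

/-- The zero morphism. -/
def zeroHom (M N : DGModule 𝓐) : M ⟶ N where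
  toLin := 0
  map_mem i m hm := zero_mem _
  map_d m := by simp

@[simp] lemma zeroHom_apply {M N : DGModule 𝓐} (m : M.carrier) :
    Hom.toLin (zeroHom M N) m = 0 := rfl

lemma Homotopic.refl {M N : DGModule 𝓐} (f : M ⟶ N) : Homotopic f f :=
  Congruence.equivalence.refl f

lemma Homotopic.symm {M N : DGModule 𝓐} {f g : M ⟶ N} (h : Homotopic f g) : Homotopic g f :=
  Congruence.equivalence.symm h

lemma Homotopic.trans {M N : DGModule 𝓐} {f g e : M ⟶ N} (h : Homotopic f g)
    (h' : Homotopic g e) : Homotopic f e :=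
  Congruence.equivalence.trans h h'

lemma Homotopic.comp_left {M N P : DGModule 𝓐} (f : M ⟶ N) {g g' : N ⟶ P}
    (h : Homotopic g g') : Homotopic (f ≫ g) (f ≫ g') :=
  HomRel.comp_left f h

lemma Homotopic.comp_right {M N P : DGModule 𝓐} {f f' : M ⟶ N} (g : N ⟶ P)
    (h : Homotopic f f') : Homotopic (f ≫ g) (f' ≫ g) :=
  HomRel.comp_right g h

lemma Homotopic.of_eq {M N : DGModule 𝓐} {f g : M ⟶ N} (h : f = g) : Homotopic f g :=
  h ▸ Homotopic.refl f

lemma homotopic_subHom_nullHom {M N : DGModule 𝓐} (f : M ⟶ N)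
    (h : M.carrier →ₗ[Aᵐᵒᵖ] N.carrier) (hh : ∀ i, ∀ m ∈ M.gr i, h m ∈ N.gr (i - 1)) :
    Homotopic f (subHom f (nullHom h hh)) :=
  ⟨h, hh, fun m => by simp⟩

lemma hom_ext {M N : DGModule 𝓐} {f g : M ⟶ N} (h : ∀ m, Hom.toLin f m = Hom.toLin g m) :
    f = g :=
  Hom.ext (LinearMap.ext h)

/-- `X` is a retract of `Y` up to homotopy. -/
def IsHRetract (X Y : DGModule 𝓐) : Prop :=
  ∃ (i : X ⟶ Y) (r : Y ⟶ X), Homotopic (i ≫ r) (𝟙 X)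

lemma IsHRetract.refl (X : DGModule 𝓐) : IsHRetract X X :=
  ⟨𝟙 X, 𝟙 X, Homotopic.of_eq (Category.comp_id _)⟩

lemma IsHRetract.trans {X Y Z : DGModule 𝓐} (h : IsHRetract X Y) (h' : IsHRetract Y Z) :
    IsHRetract X Z := by
  obtain ⟨i, r, h⟩ := h
  obtain ⟨i', r', h'⟩ := h'
  refine ⟨i ≫ i', r' ≫ r, ?_⟩
  have := Homotopic.comp_left i (h'.comp_right r)
  simp only [Category.assoc, Category.id_comp] at this ⊢
  exact this.trans h

/-- The quotient functor is full, and equality of images is homotopy because `Homotopic` is a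
congruence. -/
lemma isHRetract_iff_nonempty_retract {X Y : DGModule 𝓐} :
    IsHRetract X Y ↔ Nonempty (Retract (toHot X) (toHot Y)) := by
  constructor
  · rintro ⟨i, r, h⟩
    refine ⟨⟨(Quotient.functor _).map i, (Quotient.functor _).map r, ?_⟩⟩
    rw [← CategoryTheory.Functor.map_comp, ← CategoryTheory.Functor.map_id]
    exact CategoryTheory.Quotient.sound _ h
  · rintro ⟨ρ⟩
    obtain ⟨i, hi⟩ := (Quotient.functor (Homotopic (𝓐 := 𝓐))).map_surjective ρ.i
    obtain ⟨r, hr⟩ := (Quotient.functor (Homotopic (𝓐 := 𝓐))).map_surjective ρ.r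
    refine ⟨i, r, ?_⟩
    rw [← Quotient.functor_map_eq_iff Homotopic, CategoryTheory.Functor.map_comp, hi, hr, ρ.retract,
      CategoryTheory.Functor.map_id]

lemma IsHRetract.isPerfect {X Y : DGModule 𝓐} (h : IsHRetract X Y) (hY : IsPerfect 𝓐 (toHot Y)) :
    IsPerfect 𝓐 (toHot X) :=
  IsPerfect.retract (isHRetract_iff_nonempty_retract.mp h).some hY

/-- The identity of the underlying modules, as a map `M → {n}M`. -/
def toShift (M : DGModule 𝓐) (n : ℤ) : M.carrier →ₗ[Aᵐᵒᵖ] (M.shift n).carrier :=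
  { toFun := fun m => m, map_add' := fun _ _ => rfl, map_smul' := fun _ _ => rfl }

/-- The identity of the underlying modules, as a map `{n}M → M`. -/
def ofShift (M : DGModule 𝓐) (n : ℤ) : (M.shift n).carrier →ₗ[Aᵐᵒᵖ] M.carrier :=
  { toFun := fun m => m, map_add' := fun _ _ => rfl, map_smul' := fun _ _ => rfl }

@[simp] lemma ofShift_toShift (M : DGModule 𝓐) (n : ℤ) (m : M.carrier) :
    M.ofShift n (M.toShift n m) = m := rfl

@[simp] lemma toShift_ofShift (M : DGModule 𝓐) (n : ℤ) (m : (M.shift n).carrier) :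
    M.toShift n (M.ofShift n m) = m := rfl

lemma ofShift_injective (M : DGModule 𝓐) (n : ℤ) : Function.Injective (M.ofShift n) :=
  fun _ _ h => h

lemma ofShift_d (M : DGModule 𝓐) (n : ℤ) (m : (M.shift n).carrier) :
    M.ofShift n ((M.shift n).d m) = n.negOnePow • M.d (M.ofShift n m) := rfl

lemma d_toShift (M : DGModule 𝓐) (n : ℤ) (m : M.carrier) :
    (M.shift n).d (M.toShift n m) = n.negOnePow • M.toShift n (M.d m) := rfl

lemma toShift_mem (M : DGModule 𝓐) {n i j : ℤ} (h : i = j + n) {m : M.carrier}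
    (hm : m ∈ M.gr i) : M.toShift n m ∈ (M.shift n).gr j := by
  subst h; exact hm

lemma ofShift_mem (M : DGModule 𝓐) {n i j : ℤ} (h : j = i + n) {m : (M.shift n).carrier}
    (hm : m ∈ (M.shift n).gr i) : M.ofShift n m ∈ M.gr j := by
  subst h; exact hm

/-- The shift of a morphism. -/
def shiftMap {M N : DGModule 𝓐} (f : M ⟶ N) (n : ℤ) : M.shift n ⟶ N.shift n where
  toLin := N.toShift n ∘ₗ Hom.toLin f ∘ₗ M.ofShift n
  map_mem i m hm := Hom.map_mem f (i + n) _ hm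
  map_d m := by
    simp only [LinearMap.comp_apply, ofShift_d, d_toShift, ← Hom.map_d f]
    rcases Int.units_eq_one_or n.negOnePow with h | h <;> rw [h] <;> simp

@[simp] lemma shiftMap_apply {M N : DGModule 𝓐} (f : M ⟶ N) (n : ℤ) (m : (M.shift n).carrier) :
    Hom.toLin (shiftMap f n) m = N.toShift n (Hom.toLin f (M.ofShift n m)) := rfl

lemma Homotopic.shiftMap {M N : DGModule 𝓐} {f g : M ⟶ N} (h : Homotopic f g) (n : ℤ) :
    Homotopic (DGModule.shiftMap f n) (DGModule.shiftMap g n) := by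
  obtain ⟨h, h1, h2⟩ := h
  have h1' : ∀ i, ∀ m ∈ (M.shift n).gr i, N.toShift n (h (M.ofShift n m)) ∈
      (N.shift n).gr (i - 1) := fun i m hm =>
    N.toShift_mem (by ring) (h1 _ _ (M.ofShift_mem rfl hm))
  rcases Int.units_eq_one_or n.negOnePow with hn | hn
  · refine ⟨N.toShift n ∘ₗ h ∘ₗ M.ofShift n, h1', fun m => ?_⟩
    simp [d_toShift, ofShift_d, hn, ← map_sub, ← map_add, h2]
  -- For odd `n` both differentials change sign, which negating the homotopy offsets.
  · refine ⟨-(N.toShift n ∘ₗ h ∘ₗ M.ofShift n), fun i m hm => neg_mem (h1' i m hm), fun m => ?_⟩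
    simp [d_toShift, ofShift_d, hn, ← map_sub, ← map_add, h2]

lemma IsHRetract.shift {X Y : DGModule 𝓐} (h : IsHRetract X Y) (n : ℤ) :
    IsHRetract (X.shift n) (Y.shift n) := by
  obtain ⟨i, r, h⟩ := h
  exact ⟨shiftMap i n, shiftMap r n, h.shiftMap n⟩

section Cone

variable {M N : DGModule 𝓐} (f : M ⟶ N)

/-- The inclusion of the target in the cone. -/
def coneInl : N.carrier →ₗ[Aᵐᵒᵖ] (cone f).carrier := LinearMap.inl Aᵐᵒᵖ N.carrier M.carrier

/-- The inclusion of the source in the cone. -/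
def coneInr : M.carrier →ₗ[Aᵐᵒᵖ] (cone f).carrier := LinearMap.inr Aᵐᵒᵖ N.carrier M.carrier

/-- The projection of the cone to the target. -/
def coneFst : (cone f).carrier →ₗ[Aᵐᵒᵖ] N.carrier := LinearMap.fst Aᵐᵒᵖ N.carrier M.carrier

/-- The projection of the cone to the source. -/
def coneSnd : (cone f).carrier →ₗ[Aᵐᵒᵖ] M.carrier := LinearMap.snd Aᵐᵒᵖ N.carrier M.carrier

@[simp] lemma coneFst_coneInl (n : N.carrier) : coneFst f (coneInl f n) = n := rfl
@[simp] lemma coneSnd_coneInl (n : N.carrier) : coneSnd f (coneInl f n) = 0 := rfl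
@[simp] lemma coneFst_coneInr (m : M.carrier) : coneFst f (coneInr f m) = 0 := rfl
@[simp] lemma coneSnd_coneInr (m : M.carrier) : coneSnd f (coneInr f m) = m := rfl

variable {f} in
lemma cone_ext {x y : (cone f).carrier} (h1 : coneFst f x = coneFst f y)
    (h2 : coneSnd f x = coneSnd f y) : x = y :=
  Prod.ext h1 h2

lemma coneInl_add_coneInr (x : (cone f).carrier) :
    coneInl f (coneFst f x) + coneInr f (coneSnd f x) = x :=
  cone_ext (by simp) (by simp)

@[simp] lemma coneFst_d (x : (cone f).carrier) :
    coneFst f ((cone f).d x) = N.d (coneFst f x) + Hom.toLin f (coneSnd f x) := rfl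

@[simp] lemma coneSnd_d (x : (cone f).carrier) :
    coneSnd f ((cone f).d x) = - M.d (coneSnd f x) := rfl

@[simp] lemma d_coneInl (n : N.carrier) : (cone f).d (coneInl f n) = coneInl f (N.d n) :=
  cone_ext (by simp) (by simp)

@[simp] lemma d_coneInr (m : M.carrier) :
    (cone f).d (coneInr f m) = coneInl f (Hom.toLin f m) - coneInr f (M.d m) :=
  cone_ext (by simp) (by simp)

lemma coneInl_mem {i : ℤ} {n : N.carrier} (h : n ∈ N.gr i) : coneInl f n ∈ (cone f).gr i :=
  ⟨h, zero_mem _⟩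

lemma coneInr_mem {i j : ℤ} (hij : i = j + 1) {m : M.carrier} (h : m ∈ M.gr i) :
    coneInr f m ∈ (cone f).gr j := by
  subst hij; exact ⟨zero_mem _, h⟩

/-- The inclusion `N ⟶ cone f`. -/
def coneInlHom : N ⟶ cone f where
  toLin := coneInl f
  map_mem _ _ hm := coneInl_mem f hm
  map_d m := by simp

@[simp] lemma coneInlHom_apply (n : N.carrier) :
    Hom.toLin (coneInlHom f) n = coneInl f n := rfl

/-- The projection `cone f ⟶ {1}M`. -/
def coneSndHom : cone f ⟶ M.shift 1 where
  toLin := M.toShift 1 ∘ₗ coneSnd f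
  map_mem i m hm := hm.2
  map_d m := by simp [d_toShift]

@[simp] lemma coneSndHom_apply (x : (cone f).carrier) :
    Hom.toLin (coneSndHom f) x = M.toShift 1 (coneSnd f x) := rfl

end Cone

/-- The cone of a morphism between retracts is a retract of the cone of the induced morphism. -/
lemma isHRetract_cone {X X' P P' : DGModule 𝓐} (f : X ⟶ X') {i : X ⟶ P} {r : P ⟶ X}
    {i' : X' ⟶ P'} {r' : P' ⟶ X'} (h : Homotopic (i ≫ r) (𝟙 X))
    (h' : Homotopic (i' ≫ r') (𝟙 X')) : IsHRetract (cone f) (cone (r ≫ f ≫ i')) := by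
  obtain ⟨s, s1, s2⟩ := h
  obtain ⟨t, t1, t2⟩ := h'
  simp only [comp_toLin, id_toLin] at s2 t2
  let F := Hom.toLin f
  let I := Hom.toLin i
  let I' := Hom.toLin i'
  let R := Hom.toLin r
  let R' := Hom.toLin r'
  let g := r ≫ f ≫ i'
  -- The square formed by `i`, `i'`, `f`, `g` commutes only up to the homotopy induced by `s`, and
  -- the one formed by `r`, `r'` up to that induced by `t`. The terms `I' F s` and `t F R` correct
  -- the maps of cones accordingly.
  refine ⟨⟨coneInl g ∘ₗ (I' ∘ₗ coneFst f - I' ∘ₗ F ∘ₗ s ∘ₗ coneSnd f) +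
      coneInr g ∘ₗ I ∘ₗ coneSnd f, fun j m hm => ?_, fun m => ?_⟩,
    ⟨coneInl f ∘ₗ (R' ∘ₗ coneFst g + t ∘ₗ F ∘ₗ R ∘ₗ coneSnd g) +
      coneInr f ∘ₗ R ∘ₗ coneSnd g, fun j m hm => ?_, fun m => ?_⟩,
    coneInl f ∘ₗ (t ∘ₗ coneFst f - t ∘ₗ F ∘ₗ s ∘ₗ coneSnd f) - coneInr f ∘ₗ s ∘ₗ coneSnd f,
    fun j m hm => ?_, fun m => ?_⟩
  · refine add_mem (coneInl_mem _ (sub_mem (Hom.map_mem i' _ _ hm.1)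
      (Hom.map_mem i' _ _ (Hom.map_mem f _ _ ?_)))) (coneInr_mem _ rfl (Hom.map_mem i _ _ hm.2))
    have := s1 _ _ hm.2
    rwa [add_sub_cancel_right] at this
  · refine cone_ext ?_ ?_
    · have := congrArg (fun x => I' (F x)) (s2 (coneSnd f m))
      simp [I', F, Hom.map_d] at this
      simp [g, I, I', F, Hom.map_d]
      rw [← sub_eq_zero] at this ⊢
      rw [← neg_eq_zero, ← this]; abel
    · simp [g, I, Hom.map_d]
  · refine add_mem (coneInl_mem _ (add_mem (Hom.map_mem r' _ _ hm.1) ?_))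
      (coneInr_mem _ rfl (Hom.map_mem r _ _ hm.2))
    have := t1 _ _ (Hom.map_mem f _ _ (Hom.map_mem r _ _ hm.2))
    rwa [add_sub_cancel_right] at this
  · refine cone_ext ?_ ?_
    · have := t2 (F (R (coneSnd g m)))
      simp [R, F] at this
      simp [g, R, R', F, Hom.map_d]
      rw [← sub_eq_zero] at this ⊢
      rw [← this]; abel
    · simp [g, R, Hom.map_d]
  · have h2 := t1 _ _ (Hom.map_mem f _ _ (s1 _ _ hm.2))
    rw [add_sub_cancel_right] at h2
    exact sub_mem (coneInl_mem _ (sub_mem (t1 _ _ hm.1) h2))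
      (coneInr_mem _ (by ring) (s1 _ _ hm.2))
  · refine cone_ext ?_ ?_
    · have e1 := t2 (coneFst f m)
      have e3 := congrArg (fun x => t (F x)) (s2 (coneSnd f m))
      have e4 := t2 (F (s (coneSnd f m)))
      simp [F, Hom.map_d] at e1 e3 e4
      simp [g, I, I', F, R, R']
      rw [← sub_eq_zero] at e1 e3 e4 ⊢
      have : ∀ a b c : X'.carrier, a = 0 → b = 0 → c = 0 → a + b - c = 0 := by
        rintro _ _ _ rfl rfl rfl; simp
      rw [← this _ _ _ e1 e3 e4]
      abel
    · have e2 := s2 (coneSnd f m)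
      simp [g, I, R] at e2 ⊢
      rw [e2]

/-- The identity of the underlying modules, as a map `A → 𝓐`. -/
def toRegular (𝓐 : DGAlgebra k A) : A →ₗ[Aᵐᵒᵖ] (regular 𝓐).carrier :=
  { toFun := fun m => m, map_add' := fun _ _ => rfl, map_smul' := fun _ _ => rfl }

/-- The identity of the underlying modules, as a map `𝓐 → A`. -/
def ofRegular (𝓐 : DGAlgebra k A) : (regular 𝓐).carrier →ₗ[Aᵐᵒᵖ] A :=
  { toFun := fun m => m, map_add' := fun _ _ => rfl, map_smul' := fun _ _ => rfl }

lemma d_toRegular (a : A) : (regular 𝓐).d (toRegular 𝓐 a) = toRegular 𝓐 (𝓐.d a) := rfl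

lemma ofRegular_d (a : (regular 𝓐).carrier) :
    ofRegular 𝓐 ((regular 𝓐).d a) = 𝓐.d (ofRegular 𝓐 a) := rfl

lemma mem_regular_gr (i : ℤ) (a : (regular 𝓐).carrier) :
    a ∈ (regular 𝓐).gr i ↔ ofRegular 𝓐 a ∈ 𝓐.gr i := Iff.rfl

end DGModule

end PerfectDG

namespace PerfectDG

variable {k : Type w} [CommRing k] {A : Type u} [Ring A] [Algebra k A]

/-! ### Compression by idempotents, primitive idempotents of `A⁰`, cell bases. -/

namespace DGModule

variable {𝓐 : DGAlgebra k A}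

/-- Given a homogeneous idempotent `p` of degree zero on `M` with `(p d)² = 0` on the range of
`p`, the dg module with underlying graded module `range p` and differential `p d`. -/
def compress (M : DGModule 𝓐) (p : M.carrier →ₗ[Aᵐᵒᵖ] M.carrier)
    (hp : ∀ m, p (p m) = p m) (hgr : ∀ i, ∀ m ∈ M.gr i, p m ∈ M.gr i)
    (hd : ∀ m, p (M.d (p (M.d (p m)))) = 0) : DGModule 𝓐 where
  carrier := LinearMap.range p
  gr i := (M.gr i).comap (LinearMap.range p).subtype.toAddMonoidHom
  gr_indep := by
    intro i
    rw [disjoint_iff_inf_le]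
    intro x ⟨hx1, hx2⟩
    have key : (⨆ (j) (_ : j ≠ i), (M.gr j).comap (LinearMap.range p).subtype.toAddMonoidHom) ≤
        (⨆ (j) (_ : j ≠ i), M.gr j).comap (LinearMap.range p).subtype.toAddMonoidHom :=
      iSup₂_le fun j hj => AddSubgroup.comap_mono (le_iSup₂ (f := fun j (_ : j ≠ i) => M.gr j) j hj)
    exact Subtype.ext (AddSubgroup.disjoint_def.mp (M.gr_indep i) hx1 (key hx2))
  gr_iSup := by
    rw [eq_top_iff]
    rintro ⟨_, y, rfl⟩ _
    refine M.homogeneous_induction (P := fun y => p.rangeRestrict y ∈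
      ⨆ i, (M.gr i).comap (LinearMap.range p).subtype.toAddMonoidHom) ?_ ?_ ?_ y
    · rw [map_zero]
      exact zero_mem _
    · intro x y hx hy
      rw [map_add]
      exact add_mem hx hy
    · intro i x hx
      exact (le_iSup (fun i => (M.gr i).comap (LinearMap.range p).subtype.toAddMonoidHom) i)
        (hgr i x hx)
  smul_mem i j m hm a ha := M.smul_mem i j m.1 hm a ha
  d := (p.rangeRestrict.toAddMonoidHom.comp M.d).comp (LinearMap.range p).subtype.toAddMonoidHom
  d_mem i m hm := hgr _ _ (M.d_mem i m.1 hm)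
  d_d m := by
    obtain ⟨_, y, rfl⟩ := m
    exact Subtype.ext (hd y)
  d_smul i m hm a := by
    obtain ⟨_, y, rfl⟩ := m
    refine Subtype.ext ?_
    have h := M.d_smul i (p y) hm a
    change p (M.d (op a • p y)) = _
    rw [h]
    rcases Int.units_eq_one_or i.negOnePow with h | h <;> rw [h] <;> simp [hp]

section Compress

variable (M : DGModule 𝓐) (p : M.carrier →ₗ[Aᵐᵒᵖ] M.carrier)
    (hp : ∀ m, p (p m) = p m) (hgr : ∀ i, ∀ m ∈ M.gr i, p m ∈ M.gr i)
    (hd : ∀ m, p (M.d (p (M.d (p m)))) = 0)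

/-- The inclusion of `compress M p` in `M`. -/
def compressIncl : (M.compress p hp hgr hd).carrier →ₗ[Aᵐᵒᵖ] M.carrier :=
  (LinearMap.range p).subtype

/-- The projection from `M` to `compress M p`. -/
def compressProj : M.carrier →ₗ[Aᵐᵒᵖ] (M.compress p hp hgr hd).carrier :=
  p.rangeRestrict

@[simp] lemma compressIncl_compressProj (m : M.carrier) :
    M.compressIncl p hp hgr hd (M.compressProj p hp hgr hd m) = p m := rfl

lemma compressIncl_injective : Function.Injective (M.compressIncl p hp hgr hd) :=
  Subtype.val_injective

@[simp] lemma apply_compressIncl (x : (M.compress p hp hgr hd).carrier) :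
    p (M.compressIncl p hp hgr hd x) = M.compressIncl p hp hgr hd x := by
  obtain ⟨_, y, rfl⟩ := x
  exact hp y

@[simp] lemma compressProj_compressIncl (x : (M.compress p hp hgr hd).carrier) :
    M.compressProj p hp hgr hd (M.compressIncl p hp hgr hd x) = x :=
  M.compressIncl_injective p hp hgr hd (by simp)

lemma compressIncl_mem {i : ℤ} {x : (M.compress p hp hgr hd).carrier}
    (hx : x ∈ (M.compress p hp hgr hd).gr i) : M.compressIncl p hp hgr hd x ∈ M.gr i := hx

lemma compressProj_mem {i : ℤ} {x : M.carrier} (hx : x ∈ M.gr i) :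
    M.compressProj p hp hgr hd x ∈ (M.compress p hp hgr hd).gr i := hgr i x hx

lemma compress_d (x : (M.compress p hp hgr hd).carrier) : (M.compress p hp hgr hd).d x =
    M.compressProj p hp hgr hd (M.d (M.compressIncl p hp hgr hd x)) := rfl

end Compress

end DGModule

variable (𝓐 : DGAlgebra k A)

/-- Idempotents `e` of `A⁰` such that every nonzero element of `A⁰ e` generates `A⁰ e`. -/
structure DGAlgebra.IsPrim (e : A) : Prop where
  mem : e ∈ 𝓐.gr 0
  mul_self : e * e = e
  exists_mul : ∀ x ∈ 𝓐.gr 0, x * e ≠ 0 → ∃ y ∈ 𝓐.gr 0, y * (x * e) = e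

variable {𝓐}

lemma DGAlgebra.mul_mem_zero {a b : A} (ha : a ∈ 𝓐.gr 0) (hb : b ∈ 𝓐.gr 0) : a * b ∈ 𝓐.gr 0 := by
  simpa using SetLike.mul_mem_graded ha hb

/-- Schur's lemma. -/
lemma DGAlgebra.IsPrim.exists_inverse {e e' a : A} (he : 𝓐.IsPrim e) (he' : 𝓐.IsPrim e')
    (ha : a ∈ 𝓐.gr 0) (ha0 : a ≠ 0) (hea : e * a = a) (hae : a * e' = a) :
    ∃ c ∈ 𝓐.gr 0, c * a = e' ∧ a * c = e ∧ e' * c = c ∧ c * e = c := by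
  obtain ⟨y, hy, h⟩ := he'.exists_mul a ha (by rwa [hae])
  rw [hae] at h
  have h1 : (e' * y * e) * a = e' := by
    rw [mul_assoc, hea, mul_assoc, h, he'.mul_self]
  have hc : e' * y * e ∈ 𝓐.gr 0 := mul_mem_zero (mul_mem_zero he'.mem hy) he.mem
  refine ⟨e' * y * e, hc, h1, ?_, ?_, ?_⟩
  -- Otherwise `e - a c` generates `A⁰ e`, so `e` is a multiple of it; but `(e - a c) a = 0`, which
  -- forces `a = e a = 0`.
  · by_contra hne
    have hx : (e - a * (e' * y * e)) * e = e - a * (e' * y * e) := by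
      rw [sub_mul, he.mul_self, mul_assoc, mul_assoc _ e e, he.mul_self]
    obtain ⟨z, -, hz⟩ := he.exists_mul (e - a * (e' * y * e))
      (sub_mem he.mem (mul_mem_zero ha hc))
      (by rw [hx]; exact fun h0 => hne (sub_eq_zero.mp h0).symm)
    rw [hx] at hz
    apply ha0
    rw [← hea, ← hz, mul_assoc, sub_mul, mul_assoc, h1, hea, hae, sub_self, mul_zero]
  · rw [← mul_assoc, ← mul_assoc, he'.mul_self]
  · rw [mul_assoc, he.mul_self]

/-- A finite semifree presentation of a dg module: a basis by homogeneous elements `v l` with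
annihilators given by primitive idempotents, together with its dual basis. The triangularity
condition on the differential is only imposed on the components of degrees zero and one of its
matrix. -/
structure CellBasis (M : DGModule 𝓐) (ι : Type) [LinearOrder ι] [Fintype ι] where
  deg : ι → ℤ
  e : ι → A
  v : ι → M.carrier
  coord : ι → M.carrier →ₗ[Aᵐᵒᵖ] A
  prim : ∀ l, 𝓐.IsPrim (e l)
  v_mem : ∀ l, v l ∈ M.gr (deg l)
  coord_mem : ∀ l i, ∀ m ∈ M.gr i, coord l m ∈ 𝓐.gr (i - deg l)
  coord_self : ∀ l, coord l (v l) = e l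
  coord_ne : ∀ l j, l ≠ j → coord l (v j) = 0
  sum_coord : ∀ m, ∑ l, op (coord l m) • v l = m
  triangular : ∀ l j, j ≤ l → (deg l = deg j ∨ deg l = deg j + 1) → coord l (M.d (v j)) = 0

namespace CellBasis

variable {M N : DGModule 𝓐} {ι : Type} [LinearOrder ι] [Fintype ι] (B : CellBasis M ι)

lemma e_mul_coord (l : ι) (m : M.carrier) : B.e l * B.coord l m = B.coord l m := by
  conv_rhs => rw [← B.sum_coord m]
  rw [map_sum, Finset.sum_eq_single l]
  · rw [map_smul, B.coord_self, op_smul_eq_mul]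
  · intro j _ hj
    rw [map_smul, B.coord_ne _ _ hj.symm, smul_zero]
  · simp

lemma smul_v (l : ι) : op (B.e l) • B.v l = B.v l := by
  conv_rhs => rw [← B.sum_coord (B.v l)]
  rw [Finset.sum_eq_single l]
  · rw [B.coord_self]
  · intro j _ hj
    rw [B.coord_ne _ _ hj, op_zero, zero_smul]
  · simp

lemma ext_coord {x y : M.carrier} (h : ∀ l, B.coord l x = B.coord l y) : x = y := by
  rw [← B.sum_coord x, ← B.sum_coord y]
  simp [h]

lemma linearMap_ext {P : Type*} [AddCommGroup P] [Module Aᵐᵒᵖ P] {f g : M.carrier →ₗ[Aᵐᵒᵖ] P}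
    (h : ∀ l, f (B.v l) = g (B.v l)) : f = g := by
  ext x
  rw [← B.sum_coord x]
  simp [h]

/-- The linear map sending `v l` to `w l`, provided `w l = w l e l`. -/
def lift (w : ι → N.carrier) : M.carrier →ₗ[Aᵐᵒᵖ] N.carrier where
  toFun m := ∑ l, op (B.coord l m) • w l
  map_add' x y := by simp [add_smul, Finset.sum_add_distrib]
  map_smul' r x := by
    obtain ⟨a, rfl⟩ := op_surjective r
    simp [Finset.smul_sum, mul_smul]

lemma lift_apply (w : ι → N.carrier) (m : M.carrier) :
    B.lift w m = ∑ l, op (B.coord l m) • w l := rfl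

lemma lift_v (w : ι → N.carrier) (l : ι) : B.lift w (B.v l) = op (B.e l) • w l := by
  rw [lift_apply, Finset.sum_eq_single l]
  · rw [B.coord_self]
  · intro j _ hj
    rw [B.coord_ne _ _ hj, op_zero, zero_smul]
  · simp

lemma lift_mem {w : ι → N.carrier} {n : ℤ} (hw : ∀ l, w l ∈ N.gr (B.deg l + n)) {i : ℤ}
    {m : M.carrier} (hm : m ∈ M.gr i) : B.lift w m ∈ N.gr (i + n) := by
  refine sum_mem fun l _ => ?_
  have := N.smul_mem _ _ _ (hw l) _ (B.coord_mem l i m hm)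
  rwa [show B.deg l + n + (i - B.deg l) = i + n by ring] at this

/-- The matrix of the differential in a basis. -/
def mat (l j : ι) : A := B.coord l (M.d (B.v j))

lemma mat_mem (l j : ι) : B.mat l j ∈ 𝓐.gr (B.deg j + 1 - B.deg l) :=
  B.coord_mem _ _ _ (M.d_mem _ _ (B.v_mem j))

lemma e_mul_mat (l j : ι) : B.e l * B.mat l j = B.mat l j := B.e_mul_coord _ _

lemma sum_mat (j : ι) : ∑ l, op (B.mat l j) • B.v l = M.d (B.v j) := B.sum_coord _

lemma smul_d_v (hd : ∀ a ∈ 𝓐.gr 0, 𝓐.d a = 0) (j : ι) :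
    op (B.e j) • M.d (B.v j) = M.d (B.v j) := by
  have := M.d_smul _ _ (B.v_mem j) (B.e j)
  rw [B.smul_v, hd _ (B.prim j).mem] at this
  simpa using this.symm

lemma mat_mul_e (hd : ∀ a ∈ 𝓐.gr 0, 𝓐.d a = 0) (l j : ι) :
    B.mat l j * B.e j = B.mat l j := by
  rw [mat, ← op_smul_eq_mul, ← map_smul, B.smul_d_v hd]

lemma mat_eq_zero_of_lt (hpos : ∀ i : ℤ, i < 0 → 𝓐.gr i = ⊥) {l j : ι}
    (h : B.deg j + 1 < B.deg l) : B.mat l j = 0 := by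
  have := B.mat_mem l j
  rwa [hpos _ (by omega), Submodule.mem_bot] at this

lemma coord_eq_zero_of_lt (hpos : ∀ i : ℤ, i < 0 → 𝓐.gr i = ⊥) {l : ι} {i : ℤ} {m : M.carrier}
    (hm : m ∈ M.gr i) (h : i < B.deg l) : B.coord l m = 0 := by
  have := B.coord_mem l i m hm
  rwa [hpos _ (by omega), Submodule.mem_bot] at this

/-- The projection to the span of the `v l` with `l ∈ s`. -/
def proj (s : Set ι) [DecidablePred (· ∈ s)] : M.carrier →ₗ[Aᵐᵒᵖ] M.carrier :=
  B.lift fun l => if l ∈ s then B.v l else 0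

section proj

variable (s : Set ι) [DecidablePred (· ∈ s)]

lemma proj_v (l : ι) : B.proj s (B.v l) = if l ∈ s then B.v l else 0 := by
  rw [proj, lift_v]
  split_ifs <;> simp [smul_v]

lemma coord_proj (l : ι) (m : M.carrier) :
    B.coord l (B.proj s m) = if l ∈ s then B.coord l m else 0 := by
  rw [proj, lift_apply, map_sum, Finset.sum_eq_single l]
  · rw [map_smul]
    split_ifs <;> simp [B.coord_self, B.e_mul_coord]
  · intro j _ hj
    rw [map_smul]
    split_ifs
    · rw [B.coord_ne _ _ hj.symm, smul_zero]
    · simp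
  · simp

lemma proj_proj (m : M.carrier) : B.proj s (B.proj s m) = B.proj s m := by
  refine B.ext_coord fun l => ?_
  simp only [coord_proj]
  split_ifs <;> rfl

lemma proj_mem (i : ℤ) (m : M.carrier) (hm : m ∈ M.gr i) : B.proj s m ∈ M.gr i := by
  have := B.lift_mem (N := M) (w := fun l => if l ∈ s then B.v l else 0) (n := 0) (fun l => by
    split_ifs
    · simpa using B.v_mem l
    · exact zero_mem _) hm
  rwa [add_zero] at this

lemma proj_eq_self_iff (m : M.carrier) : B.proj s m = m ↔ ∀ l ∉ s, B.coord l m = 0 := by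
  constructor
  · intro h l hl
    rw [← h, coord_proj, if_neg hl]
  · intro h
    refine B.ext_coord fun l => ?_
    rw [coord_proj]
    split_ifs with hl
    · rfl
    · exact (h l hl).symm

lemma proj_eq_zero_iff (m : M.carrier) : B.proj s m = 0 ↔ ∀ l ∈ s, B.coord l m = 0 := by
  constructor
  · intro h l hl
    have := B.coord_proj s l m
    rwa [h, map_zero, if_pos hl, eq_comm] at this
  · intro h
    refine B.ext_coord fun l => ?_
    rw [coord_proj, map_zero]
    split_ifs with hl
    · exact h l hl
    · rfl

end proj

lemma d_smul_v (l : ι) (a : A) : M.d (op a • B.v l) =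
    op a • M.d (B.v l) + (B.deg l).negOnePow • (op (𝓐.d a) • B.v l) :=
  M.d_smul _ _ (B.v_mem l) a

/-- A coordinate of the differential vanishes as soon as the relevant entries of the matrix
vanish. -/
lemma coord_d_eq_zero {l : ι} {m : M.carrier}
    (h : ∀ j, B.coord j m ≠ 0 → j ≠ l ∧ B.mat l j = 0) : B.coord l (M.d m) = 0 := by
  rw [← B.sum_coord m, map_sum, map_sum]
  refine Finset.sum_eq_zero fun j _ => ?_
  by_cases hj : B.coord j m = 0
  · simp [hj]
  · obtain ⟨h1, h2⟩ := h j hj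
    rw [d_smul_v, map_add, map_smul, ← mat, h2, smul_zero, zero_add]
    rcases Int.units_eq_one_or (B.deg j).negOnePow with h | h <;> rw [h] <;>
      simp [B.coord_ne _ _ h1.symm]

end CellBasis

end PerfectDG

namespace PerfectDG

/-! ### Cell bases of `𝓐`, shifts, cones and compressions. -/

variable {k : Type w} [CommRing k] {A : Type u} [Ring A] [Algebra k A] {𝓐 : DGAlgebra k A}

/-- In a semisimple ring, `1` is a sum of orthogonal primitive idempotents. -/
lemma DGAlgebra.exists_isPrim_sum_eq_one (𝓐 : DGAlgebra k A) (hss : IsSemisimpleRing ↥(𝓐.gr 0)) :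
    ∃ (n : ℕ) (ε : Fin n → A), (∀ l, 𝓐.IsPrim (ε l)) ∧ ∑ l, ε l = 1 ∧
      ∀ l j, l ≠ j → ε l * ε j = 0 := by
  obtain ⟨n, S, φ, hS⟩ := IsSemisimpleModule.exists_linearEquiv_fin_dfinsupp ↥(𝓐.gr 0) ↥(𝓐.gr 0)
  let ε : Fin n → ↥(𝓐.gr 0) := fun l => φ.symm (DFinsupp.single l (φ 1 l))
  have hsmul : ∀ (x : ↥(𝓐.gr 0)) (l : Fin n) (y : S l),
      (DFinsupp.single l (x • y) : Π₀ i, S i) = x • DFinsupp.single l y := fun x l y =>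
    (DFinsupp.lsingle (R := ↥(𝓐.gr 0)) (M := fun i => S i) l).map_smul x y
  -- Right multiplication by `ε l` is the projection of `A⁰` to its `l`-th simple summand;
  -- idempotence, orthogonality and primitivity all follow.
  have hmul : ∀ x l, x * ε l = φ.symm (DFinsupp.single l (φ x l)) := fun x l => by
    have h1 : φ x = x • φ 1 := by rw [← map_smul, smul_eq_mul, mul_one]
    rw [h1, DFinsupp.smul_apply, hsmul, map_smul, smul_eq_mul]
  have hε : ∀ l, φ (ε l) = DFinsupp.single l (φ 1 l) := fun l => by simp [ε]
  refine ⟨n, fun l => (ε l : A), fun l => ⟨(ε l).2, ?_, ?_⟩, ?_, ?_⟩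
  · have : ε l * ε l = ε l := by
      rw [hmul, hε, DFinsupp.single_eq_same]
    exact congrArg Subtype.val this
  · intro x hx hne
    have hne' : φ ⟨x, hx⟩ l ≠ 0 := fun h => hne (by
      have := hmul ⟨x, hx⟩ l
      rw [h, DFinsupp.single_zero, map_zero] at this
      exact congrArg Subtype.val this)
    have := hS l
    obtain ⟨y, hy⟩ := IsSimpleModule.toSpanSingleton_surjective ↥(𝓐.gr 0) hne' (φ 1 l)
    refine ⟨y, y.2, ?_⟩
    have h : y * (⟨x, hx⟩ * ε l) = ε l := by
      rw [hmul, ← smul_eq_mul, ← map_smul, ← hsmul]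
      rw [LinearMap.toSpanSingleton_apply] at hy
      rw [hy]
    exact congrArg Subtype.val h
  · have : ∑ l, ε l = 1 := by
      simp only [ε]
      rw [← map_sum, φ.symm_apply_eq]
      ext l
      simp [DFinsupp.finsetSum_apply, DFinsupp.single_apply]
    have := congrArg (𝓐.gr 0).subtype this
    simpa using this
  · intro l j hlj
    have : ε l * ε j = 0 := by
      rw [hmul, hε, DFinsupp.single_eq_of_ne hlj.symm, DFinsupp.single_zero, map_zero]
    exact congrArg Subtype.val this

namespace CellBasis

open DGModule

variable {M N : DGModule 𝓐} {ι κ : Type} [LinearOrder ι] [Fintype ι] [LinearOrder κ] [Fintype κ]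

/-- The basis of the regular module given by orthogonal idempotents. -/
def regular (hd : ∀ a ∈ 𝓐.gr 0, 𝓐.d a = 0) {n : ℕ} (ε : Fin n → A) (h : ∀ l, 𝓐.IsPrim (ε l))
    (hsum : ∑ l, ε l = 1) (hε : ∀ l j, l ≠ j → ε l * ε j = 0) :
    CellBasis (DGModule.regular 𝓐) (Fin n) where
  deg _ := 0
  e := ε
  v l := toRegular 𝓐 (ε l)
  coord l :=
    { toFun := fun a => ε l * ofRegular 𝓐 a
      map_add' := fun x y => by rw [map_add, mul_add]
      map_smul' := fun r x => by
        obtain ⟨a, rfl⟩ := op_surjective r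
        simp [mul_assoc] }
  prim := h
  v_mem l := (h l).mem
  coord_mem l i a ha := by
    have := SetLike.mul_mem_graded (h l).mem ((mem_regular_gr i a).mp ha)
    simpa using this
  coord_self l := (h l).mul_self
  coord_ne l j hlj := hε l j hlj
  sum_coord a := by
    change ∑ l, op (ε l * ofRegular 𝓐 a) • toRegular 𝓐 (ε l) = a
    simp_rw [← map_smul, op_smul_eq_mul, ← map_sum, ← mul_assoc, (h _).mul_self,
      ← Finset.sum_mul, hsum, one_mul]
    rfl
  triangular l j _ _ := by
    change ε l * 𝓐.d (ε j) = 0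
    rw [hd _ (h j).mem, mul_zero]

/-- The shift of a basis. -/
def shift (B : CellBasis M ι) (n : ℤ) : CellBasis (M.shift n) ι where
  deg l := B.deg l - n
  e := B.e
  v l := M.toShift n (B.v l)
  coord l := B.coord l ∘ₗ M.ofShift n
  prim := B.prim
  v_mem l := M.toShift_mem (by ring) (B.v_mem l)
  coord_mem l i m hm := by
    have := B.coord_mem l _ _ (M.ofShift_mem rfl hm)
    rwa [show i + n - B.deg l = i - (B.deg l - n) by ring] at this
  coord_self := B.coord_self
  coord_ne := B.coord_ne
  sum_coord := B.sum_coord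
  triangular l j hlj h := by
    have := B.triangular l j hlj (by omega)
    rw [d_toShift, LinearMap.comp_apply]
    rcases Int.units_eq_one_or n.negOnePow with h | h <;> rw [h] <;> simp [this]

/-- The basis of a cone. -/
def cone (B : CellBasis M ι) (C : CellBasis N κ) (f : M ⟶ N) :
    CellBasis (DGModule.cone f) (κ ⊕ₗ ι) where
  deg l := Sum.elim C.deg (fun l => B.deg l - 1) (ofLex l)
  e l := Sum.elim C.e B.e (ofLex l)
  v l := Sum.elim (fun l => coneInl f (C.v l)) (fun l => coneInr f (B.v l)) (ofLex l)
  coord l := Sum.elim (fun l => C.coord l ∘ₗ coneFst f) (fun l => B.coord l ∘ₗ coneSnd f) (ofLex l)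
  prim l := by
    cases l using Lex.rec with | _ l
    rcases l with l | l
    · exact C.prim l
    · exact B.prim l
  v_mem l := by
    cases l using Lex.rec with | _ l
    rcases l with l | l
    · exact coneInl_mem f (C.v_mem l)
    · exact coneInr_mem f (by simp) (B.v_mem l)
  coord_mem l i m hm := by
    cases l using Lex.rec with | _ l
    rcases l with l | l
    · exact C.coord_mem l i _ hm.1
    · have := B.coord_mem l _ _ hm.2
      rwa [show i + 1 - B.deg l = i - (B.deg l - 1) by ring] at this
  coord_self l := by
    cases l using Lex.rec with | _ l
    rcases l with l | l
    · exact C.coord_self l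
    · exact B.coord_self l
  coord_ne l j hlj := by
    cases l using Lex.rec with | _ l
    cases j using Lex.rec with | _ j
    rcases l with l | l <;> rcases j with j | j
    · exact C.coord_ne l j (fun h => hlj (by rw [h]))
    · simp
    · simp
    · exact B.coord_ne l j (fun h => hlj (by rw [h]))
  sum_coord m := by
    rw [← (toLex (α := κ ⊕ ι)).sum_comp, Fintype.sum_sum_type]
    refine cone_ext ?_ ?_
    · simp [C.sum_coord]
    · simp [B.sum_coord]
  -- In `κ ⊕ₗ ι` the target comes first: `d` preserves it, and the entries coming from `f` lead from
  -- `ι` down to `κ`.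
  triangular l j hlj h := by
    cases l using Lex.rec with | _ l
    cases j using Lex.rec with | _ j
    rcases l with l | l <;> rcases j with j | j
    · simpa using C.triangular l j (by simpa using hlj) (by simpa using h)
    · exact absurd hlj (by simp)
    · simp
    · have := B.triangular l j (by simpa using hlj) (by simp at h; omega)
      simpa using this

/-- A basis of `compress M p` extracted from a basis of `M`. -/
def compress (B : CellBasis M ι) (p : M.carrier →ₗ[Aᵐᵒᵖ] M.carrier)
    (hp : ∀ m, p (p m) = p m) (hgr : ∀ i, ∀ m ∈ M.gr i, p m ∈ M.gr i)
    (hd : ∀ m, p (M.d (p (M.d (p m)))) = 0) (s : Set ι) [DecidablePred (· ∈ s)]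
    (hs : ∀ l ∉ s, (∀ x, B.coord l (p x) = 0) ∨ p (B.v l) = 0)
    (h1 : ∀ l ∈ s, B.coord l (p (B.v l)) = B.e l)
    (h2 : ∀ l ∈ s, ∀ j ∈ s, l ≠ j → B.coord l (p (B.v j)) = 0)
    (h3 : ∀ l ∈ s, ∀ j ∈ s, j ≤ l → (B.deg l = B.deg j ∨ B.deg l = B.deg j + 1) →
      B.coord l (p (M.d (p (B.v j)))) = 0) :
    CellBasis (M.compress p hp hgr hd) s where
  deg l := B.deg l
  e l := B.e l
  v l := M.compressProj p hp hgr hd (B.v l)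
  coord l := B.coord l ∘ₗ M.compressIncl p hp hgr hd
  prim l := B.prim l
  v_mem l := M.compressProj_mem p hp hgr hd (B.v_mem l)
  coord_mem l i m hm := B.coord_mem l i _ (M.compressIncl_mem p hp hgr hd hm)
  coord_self l := by simpa using h1 l l.2
  coord_ne l j hlj := by simpa using h2 l l.2 j j.2 (fun h => hlj (Subtype.ext h))
  sum_coord m := by
    conv_rhs => rw [← M.compressProj_compressIncl p hp hgr hd m,
      ← B.sum_coord (M.compressIncl p hp hgr hd m), map_sum]
    simp_rw [map_smul]
    refine (Finset.sum_set_coe s (f := fun l => op (B.coord l (M.compressIncl p hp hgr hd m)) •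
        M.compressProj p hp hgr hd (B.v l))).trans
      (Finset.sum_subset (Finset.subset_univ _) fun l _ hl => ?_)
    rcases hs l (by simpa using hl) with h | h
    · rw [← M.apply_compressIncl p hp hgr hd, h, op_zero, zero_smul]
    · have : M.compressProj p hp hgr hd (B.v l) = 0 :=
        M.compressIncl_injective p hp hgr hd (by simpa using h)
      rw [this, smul_zero]
  triangular l j hlj h := by
    simpa [compress_d] using h3 l l.2 j j.2 hlj h

end CellBasis

end PerfectDG

namespace PerfectDG

variable {k : Type w} [CommRing k] {A : Type u} [Ring A] [Algebra k A] {𝓐 : DGAlgebra k A}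

/-! ### Gaussian elimination and minimal bases. -/

namespace CellBasis

open DGModule

variable {M N : DGModule 𝓐} {ι κ : Type} [LinearOrder ι] [Fintype ι] [LinearOrder κ] [Fintype κ]

/-- A basis is minimal if the matrix of the differential has no entries in `A⁰`. -/
def IsMinimal (B : CellBasis M ι) : Prop := ∀ l j, B.deg l = B.deg j + 1 → B.mat l j = 0

/-- Gaussian elimination: an entry of `A⁰` in the matrix of the differential can be cancelled. -/
lemma exists_elimination (hpos : ∀ i : ℤ, i < 0 → 𝓐.gr i = ⊥) (hd : ∀ a ∈ 𝓐.gr 0, 𝓐.d a = 0)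
    (B : CellBasis M ι) (hB : ¬ B.IsMinimal) :
    ∃ (N : DGModule 𝓐) (s : Set ι) (_ : Fintype s) (C : CellBasis N s), IsHRetract M N ∧
      Fintype.card s < Fintype.card ι ∧ ∀ l, C.deg l = B.deg l := by
  classical
  have hne : (Finset.univ.filter fun i => ∃ j, B.deg j = B.deg i + 1 ∧ B.mat j i ≠ 0).Nonempty := by
    simp only [IsMinimal, not_forall] at hB
    obtain ⟨j, i, h1, h2⟩ := hB
    exact ⟨i, by simpa using ⟨j, h1, h2⟩⟩
  -- The pivot is chosen with `i` the smallest column containing a nonzero entry of `A⁰` and `j` the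
  -- largest such row in that column; this keeps the reduced matrix triangular.
  obtain ⟨i, hi, hi'⟩ := Finset.exists_min_image _ id hne
  have hne' : (Finset.univ.filter fun j => B.deg j = B.deg i + 1 ∧ B.mat j i ≠ 0).Nonempty := by
    obtain ⟨j, hj⟩ := (Finset.mem_filter.mp hi).2
    exact ⟨j, by simpa using hj⟩
  obtain ⟨j, hj, hj'⟩ := Finset.exists_max_image _ id hne'
  obtain ⟨hdeg, hmat⟩ := (Finset.mem_filter.mp hj).2
  simp only [Finset.mem_filter, Finset.mem_univ, true_and, id, forall_exists_index, and_imp]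
    at hi' hj'
  have hij : i ≠ j := fun h => by subst h; omega
  have ha := B.mat_mem j i
  rw [hdeg, sub_self] at ha
  obtain ⟨c, hc, hca, hac, -, hce⟩ := (B.prim j).exists_inverse (B.prim i) ha hmat
    (B.e_mul_mat _ _) (B.mat_mul_e hd _ _)
  -- `h` inverts the pivot: it sends `v j` to `v i c` and the other basis elements to zero. As `h h
  -- = 0` and `h d h = h`, the map `1 - (d h + h d)` is an idempotent morphism homotopic to the
  -- identity.
  let h : M.carrier →ₗ[Aᵐᵒᵖ] M.carrier := B.lift fun l => if l = j then op c • B.v i else 0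
  have happ : ∀ x, h x = op (c * B.coord j x) • B.v i := fun x => by
    simp only [h, lift_apply]
    rw [Finset.sum_eq_single j]
    · rw [if_pos rfl, smul_smul, op_mul]
    · intro l _ hl
      rw [if_neg hl, smul_zero]
    · simp
  have hh : ∀ n, ∀ m ∈ M.gr n, h m ∈ M.gr (n - 1) := fun n m hm => by
    refine B.lift_mem (n := -1) (fun l => ?_) hm
    split_ifs with hl
    · subst hl
      have := M.smul_mem _ _ _ (B.v_mem i) _ hc
      rwa [show B.deg i + 0 = B.deg l + -1 by omega] at this
    · exact zero_mem _
  have hcoord : ∀ l x, l ≠ i → B.coord l (h x) = 0 := fun l x hl => by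
    rw [happ, map_smul, B.coord_ne _ _ hl, smul_zero]
  have hcoordd : ∀ l x, l ≠ i → B.coord l (M.d (h x)) = B.mat l i * (c * B.coord j x) :=
    fun l x hl => by
      rw [happ, d_smul_v, map_add, map_smul, ← mat, op_smul_eq_mul]
      rcases Int.units_eq_one_or (B.deg i).negOnePow with h | h <;> rw [h] <;>
        simp [B.coord_ne _ _ hl]
  have hcoordj : ∀ x, B.coord j (M.d (h x)) = B.coord j x := fun x => by
    rw [hcoordd _ _ hij.symm, ← mul_assoc, hac, B.e_mul_coord]
  have hhh : ∀ x, h (h x) = 0 := fun x => by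
    rw [happ (h x), hcoord _ _ hij.symm, mul_zero, op_zero, zero_smul]
  have hdh : ∀ x, h (M.d (h x)) = h x := fun x => by
    rw [happ (M.d (h x)), hcoordj, ← happ]
  let π : M ⟶ M := subHom (𝟙 M) (nullHom h hh)
  have πapp : ∀ x, Hom.toLin π x = x - (M.d (h x) + h (M.d x)) := fun x => rfl
  have hπ : ∀ x, h (Hom.toLin π x) = 0 := fun x => by
    rw [πapp, map_sub, map_add, hdh, hhh]
    abel
  have ππ : ∀ x, Hom.toLin π (Hom.toLin π x) = Hom.toLin π x := fun x => by
    rw [πapp (Hom.toLin π x), hπ, ← Hom.map_d π, hπ, map_zero, add_zero, sub_zero]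
  have πd : ∀ x, Hom.toLin π (M.d (Hom.toLin π x)) = M.d (Hom.toLin π x) := fun x => by
    rw [Hom.map_d π, ππ]
  have hdπ : ∀ m, Hom.toLin π (M.d (Hom.toLin π (M.d (Hom.toLin π m)))) = 0 := fun m => by
    rw [πd, πd, M.d_d]
  have hv : ∀ l, l ≠ j → h (B.v l) = 0 := fun l hl => by
    rw [happ, B.coord_ne _ _ hl.symm, mul_zero, op_zero, zero_smul]
  have πv : ∀ l, l ≠ j → Hom.toLin π (B.v l) = B.v l - h (M.d (B.v l)) := fun l hl => by
    rw [πapp, hv l hl, map_zero, zero_add]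
  let s : Set ι := {l | l ≠ i ∧ l ≠ j}
  let C := B.compress (Hom.toLin π) ππ (Hom.map_mem π) hdπ s
    -- `π` kills `v i`, and the `j`-th coordinate vanishes on the image of `π`, so the basis
    -- elements in `s` suffice.
    (fun l hl => by
      by_cases hli : l = i
      · right
        subst hli
        rw [πv _ hij, happ, ← mat, hca, B.smul_v, sub_self]
      · left
        have hlj : l = j := by
          by_contra hlj
          exact hl ⟨hli, hlj⟩
        subst hlj
        intro x
        rw [πapp, map_sub, map_add, hcoordj, hcoord _ _ hli, add_zero, sub_self])
    (fun l hl => by rw [πv l hl.2, map_sub, hcoord _ _ hl.1, sub_zero, B.coord_self])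
    (fun l hl m hm hlm => by
      rw [πv m hm.2, map_sub, hcoord _ _ hl.1, sub_zero, B.coord_ne _ _ hlm])
    (fun l hl m hm hml hlm => by
      rw [πd, πv m hm.2, map_sub, map_sub, hcoordd _ _ hl.1, B.triangular l m hml hlm, zero_sub,
        neg_eq_zero, ← mat]
      -- The correction to the entry `(l, m)` is `mat l i * c * mat j m`. If both outer factors are
      -- nonzero, degrees, triangularity and the extremal choice of `i` and `j` force `l < m`.
      by_contra hne
      have h1 : B.mat l i ≠ 0 := fun h => hne (by rw [h, zero_mul])
      have h2 : B.mat j m ≠ 0 := fun h => hne (by rw [h, mul_zero, mul_zero])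
      have h3 : ¬ B.deg i + 1 < B.deg l := fun h => h1 (B.mat_eq_zero_of_lt hpos h)
      have h4 : ¬ B.deg m + 1 < B.deg j := fun h => h2 (B.mat_eq_zero_of_lt hpos h)
      rcases hlm with hlm | hlm
      · rcases eq_or_ne (B.deg l) (B.deg i) with h5 | h5
        · have h6 : l < i := not_le.mp fun h => h1 (B.triangular l i h (Or.inl h5))
          have h7 : i ≤ m := hi' m j (by omega) h2
          exact absurd hml (not_le.mpr (h6.trans_le h7))
        · have h6 : l ≤ j := hj' l (by omega) h1
          have h7 : j < m := not_le.mp fun h => h2 (B.triangular j m h (Or.inl (by omega)))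
          exact absurd hml (not_le.mpr (h6.trans_lt h7))
      · have h6 : l < i := not_le.mp fun h => h1 (B.triangular l i h (Or.inr (by omega)))
        have h7 : i ≤ m := hi' m j (by omega) h2
        exact absurd hml (not_le.mpr (h6.trans_le h7)))
  refine ⟨_, s, inferInstance, C, ⟨⟨M.compressProj _ ππ (Hom.map_mem π) hdπ, fun n m hm =>
    M.compressProj_mem _ ππ (Hom.map_mem π) hdπ hm, fun m => ?_⟩,
    ⟨M.compressIncl _ ππ (Hom.map_mem π) hdπ, fun n m hm =>
    M.compressIncl_mem _ ππ (Hom.map_mem π) hdπ hm, fun m => ?_⟩, ?_⟩, ?_, fun l => rfl⟩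
  · refine M.compressIncl_injective _ ππ (Hom.map_mem π) hdπ ?_
    simp only [compress_d, compressIncl_compressProj]
    rw [πd, Hom.map_d π]
  · obtain ⟨_, y, rfl⟩ := m
    exact πd y
  · exact (homotopic_subHom_nullHom (𝟙 M) h hh).symm
  · exact Fintype.card_subtype_lt (x := i) (p := (· ∈ s)) (fun h => h.1 rfl)

/-- Each elimination shortens the basis and keeps the degrees of the surviving elements. The clause
on degrees later confines the minimal model of a cone to degrees `0` and `-1`. -/
lemma exists_isMinimal (hpos : ∀ i : ℤ, i < 0 → 𝓐.gr i = ⊥) (hd : ∀ a ∈ 𝓐.gr 0, 𝓐.d a = 0)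
    (B : CellBasis M ι) : ∃ (N : DGModule 𝓐) (κ : Type) (_ : LinearOrder κ) (_ : Fintype κ)
      (C : CellBasis N κ), IsHRetract M N ∧ C.IsMinimal ∧ ∀ l, ∃ j, C.deg l = B.deg j := by
  induction hn : Fintype.card ι using Nat.strong_induction_on generalizing ι M with
  | _ n ih =>
    by_cases hB : B.IsMinimal
    · exact ⟨M, ι, _, _, B, IsHRetract.refl M, hB, fun l => ⟨l, rfl⟩⟩
    · obtain ⟨N, s, _, C, h1, h2, h3⟩ := exists_elimination hpos hd B hB
      obtain ⟨P, κ, _, _, D, h4, h5, h6⟩ := ih _ (hn ▸ h2) C rfl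
      refine ⟨P, κ, _, _, D, h1.trans h4, h5, fun l => ?_⟩
      obtain ⟨j, hj⟩ := h6 l
      exact ⟨j, hj.trans (h3 j)⟩

end CellBasis

open DGModule

/-- Every perfect dg module is a retract of a dg module with a finite cell basis. -/
lemma IsPerfect.exists_cellBasis (hss : IsSemisimpleRing ↥(𝓐.gr 0))
    (hd : ∀ a ∈ 𝓐.gr 0, 𝓐.d a = 0) {X : DGHot 𝓐} (hX : IsPerfect 𝓐 X) :
    ∃ (N : DGModule 𝓐) (κ : Type) (_ : LinearOrder κ) (_ : Fintype κ) (_ : CellBasis N κ),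
      IsHRetract X.as N := by
  induction hX with
  | regular =>
    obtain ⟨n, ε, h1, h2, h3⟩ := 𝓐.exists_isPrim_sum_eq_one hss
    exact ⟨_, Fin n, _, _, CellBasis.regular hd ε h1 h2 h3, IsHRetract.refl _⟩
  | shift M n _ ih =>
    obtain ⟨N, κ, _, _, B, h⟩ := ih
    exact ⟨_, κ, _, _, B.shift n, h.shift n⟩
  | @cone M N f _ _ ih1 ih2 =>
    obtain ⟨P, ι, _, _, B, i, r, h⟩ := ih1
    obtain ⟨P', κ, _, _, C, i', r', h'⟩ := ih2
    exact ⟨_, _, _, _, B.cone C (r ≫ f ≫ i'), isHRetract_cone f h h'⟩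
  | @retract X Y ρ _ ih =>
    obtain ⟨N, κ, _, _, B, h⟩ := ih
    exact ⟨N, κ, _, _, B, (isHRetract_iff_nonempty_retract.mpr ⟨ρ⟩).trans h⟩

end PerfectDG

namespace PerfectDG

/-! ### The complex `M̄`, the degree filtration and its slices. -/

variable {k : Type w} [CommRing k] {A : Type u} [Ring A] [Algebra k A] {𝓐 : DGAlgebra k A}

lemma subsingleton_gradedCohomology_iff {V : Type u} [AddCommGroup V] (gr : ℤ → AddSubgroup V)
    (d : V →+ V) (i : ℤ) : Subsingleton (gradedCohomology gr d i) ↔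
      ∀ x ∈ gr i, d x = 0 → ∃ y ∈ gr (i - 1), d y = x := by
  constructor
  · intro h x hx hdx
    let x' : ↥(gr i ⊓ d.ker) := ⟨x, hx, hdx⟩
    have := (QuotientAddGroup.eq_zero_iff (N := ((gr (i - 1)).map d).addSubgroupOf (gr i ⊓ d.ker))
      x').mp (Subsingleton.elim _ _)
    rw [AddSubgroup.mem_addSubgroupOf] at this
    exact this
  · intro h
    refine subsingleton_of_forall_eq 0 fun q => ?_
    obtain ⟨⟨x, hx, hdx⟩, rfl⟩ := QuotientAddGroup.mk_surjective q
    exact (QuotientAddGroup.eq_zero_iff _).mpr (AddSubgroup.mem_addSubgroupOf.mpr (h x hx hdx))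

namespace DGModule

lemma smul_mem_mulAugmentation (M : DGModule 𝓐) {i j : ℤ} {m : M.carrier} {a : A}
    (hm : m ∈ M.gr i) (hj : 0 < j) (ha : a ∈ 𝓐.gr j) : op a • m ∈ M.mulAugmentation :=
  AddSubgroup.subset_closure ⟨i, j, m, a, hm, hj, ha, rfl⟩

lemma linearMap_mem_mulAugmentation {M N : DGModule 𝓐} (f : M.carrier →ₗ[Aᵐᵒᵖ] N.carrier)
    (hf : ∀ i, ∀ m ∈ M.gr i, f m ∈ N.gr i) {m : M.carrier} (hm : m ∈ M.mulAugmentation) :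
    f m ∈ N.mulAugmentation := by
  have : M.mulAugmentation ≤ N.mulAugmentation.comap f.toAddMonoidHom := by
    refine (AddSubgroup.closure_le _).mpr ?_
    rintro _ ⟨i, j, m, a, hm, hj, ha, rfl⟩
    change f (op a • m) ∈ N.mulAugmentation
    rw [map_smul]
    exact N.smul_mem_mulAugmentation (hf i m hm) hj ha
  exact this hm

lemma map_mem_mulAugmentation {M N : DGModule 𝓐} (f : M ⟶ N) {m : M.carrier}
    (hm : m ∈ M.mulAugmentation) : Hom.toLin f m ∈ N.mulAugmentation :=
  linearMap_mem_mulAugmentation _ (Hom.map_mem f) hm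

lemma notMem_barSupport_iff (M : DGModule 𝓐) (i : ℤ) : i ∉ M.barSupport ↔
    ∀ m ∈ M.gr i, M.d m ∈ M.mulAugmentation →
      ∃ m' ∈ M.gr (i - 1), m - M.d m' ∈ M.mulAugmentation := by
  rw [barSupport, Set.mem_ofPred_eq, not_nontrivial_iff_subsingleton,
    subsingleton_gradedCohomology_iff]
  constructor
  · intro h m hm hdm
    obtain ⟨_, ⟨m', hm', rfl⟩, h'⟩ := h (QuotientAddGroup.mk m) ⟨m, hm, rfl⟩
      ((QuotientAddGroup.eq_zero_iff _).mpr hdm)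
    refine ⟨m', hm', ?_⟩
    have : (QuotientAddGroup.mk (M.d m') : M.Bar) = QuotientAddGroup.mk m := h'
    rw [QuotientAddGroup.eq] at this
    rwa [← neg_add_eq_sub]
  · rintro h _ ⟨m, hm, rfl⟩ hdm
    obtain ⟨m', hm', h'⟩ := h m hm ((QuotientAddGroup.eq_zero_iff _).mp hdm)
    refine ⟨_, ⟨m', hm', rfl⟩, ?_⟩
    change (QuotientAddGroup.mk (M.d m') : M.Bar) = QuotientAddGroup.mk m
    rw [QuotientAddGroup.eq, neg_add_eq_sub]
    exact h'

end DGModule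

namespace CellBasis

open DGModule

variable {M N : DGModule 𝓐} {ι κ : Type} [LinearOrder ι] [Fintype ι] [LinearOrder κ] [Fintype κ]

/-- Coordinates of homogeneous elements have nonnegative degree, so products with elements of `A⁺`
have coordinates without component in `A⁰`; but the coordinate in question lies in `A⁰`. -/
lemma coord_eq_zero_of_mem_mulAugmentation (hpos : ∀ i : ℤ, i < 0 → 𝓐.gr i = ⊥)
    (B : CellBasis M ι) {l : ι} {m : M.carrier} (hm : m ∈ M.gr (B.deg l))
    (hm' : m ∈ M.mulAugmentation) : B.coord l m = 0 := by
  let P : M.carrier →+ A := (GradedRing.proj 𝓐.gr 0).comp (B.coord l).toAddMonoidHom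
  have key : M.mulAugmentation ≤ P.ker := by
    refine (AddSubgroup.closure_le _).mpr ?_
    rintro _ ⟨i, j, x, a, hx, hj, ha, rfl⟩
    change GradedRing.proj 𝓐.gr 0 (B.coord l (op a • x)) = 0
    rw [map_smul, op_smul_eq_mul, GradedRing.proj_apply]
    rcases lt_or_ge i (B.deg l) with h | h
    · rw [B.coord_eq_zero_of_lt hpos hx h, zero_mul, DirectSum.decompose_zero]
      rfl
    · exact DirectSum.decompose_of_mem_ne _ (SetLike.mul_mem_graded (B.coord_mem l i x hx) ha)
        (by omega)
  have h1 := B.coord_mem l _ m hm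
  rw [sub_self] at h1
  have h2 : GradedRing.proj 𝓐.gr 0 (B.coord l m) = 0 := key hm'
  rwa [GradedRing.proj_apply, DirectSum.decompose_of_mem_same _ h1] at h2

/-- The purpose of minimality: `M̄` has zero differential. The remaining matrix entries have
positive degree, and so have the differentials of the coefficients. -/
lemma IsMinimal.d_mem_mulAugmentation (hpos : ∀ i : ℤ, i < 0 → 𝓐.gr i = ⊥) {B : CellBasis M ι}
    (hB : B.IsMinimal) (m : M.carrier) : M.d m ∈ M.mulAugmentation := by
  refine M.homogeneous_induction (P := fun m => M.d m ∈ M.mulAugmentation) ?_ ?_ ?_ m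
  · rw [map_zero]
    exact zero_mem _
  · intro x y hx hy
    rw [map_add]
    exact add_mem hx hy
  · intro i m hm
    rw [← B.sum_coord m, map_sum]
    refine sum_mem fun l _ => ?_
    rcases lt_or_ge i (B.deg l) with h | h
    · rw [B.coord_eq_zero_of_lt hpos hm h]
      simp
    · have ha := B.coord_mem l i m hm
      rw [d_smul_v]
      refine add_mem ?_ ?_
      · rw [← B.sum_mat, Finset.smul_sum]
        refine sum_mem fun j _ => ?_
        rcases lt_trichotomy (B.deg j) (B.deg l + 1) with h' | h' | h'
        · rw [smul_smul, ← op_mul]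
          exact M.smul_mem_mulAugmentation (B.v_mem j) (by omega)
            (SetLike.mul_mem_graded (B.mat_mem j l) ha)
        · simp [hB _ _ h']
        · simp [B.mat_eq_zero_of_lt hpos h']
      · have := M.smul_mem_mulAugmentation (B.v_mem l) (by omega) (𝓐.d_mem _ _ ha)
        rcases Int.units_eq_one_or (B.deg l).negOnePow with h | h <;> rw [h] <;> simpa using this

/-- The submodule generated by the basis elements of degree at most `q`. -/
def filt (B : CellBasis M ι) (q : ℤ) : Submodule Aᵐᵒᵖ M.carrier :=
  ⨅ (l) (_ : q < B.deg l), LinearMap.ker (B.coord l)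

lemma mem_filt (B : CellBasis M ι) (q : ℤ) (m : M.carrier) :
    m ∈ B.filt q ↔ ∀ l, q < B.deg l → B.coord l m = 0 := by
  simp [filt, Submodule.mem_iInf]

section Slice

variable (hpos : ∀ i : ℤ, i < 0 → 𝓐.gr i = ⊥) {B : CellBasis M ι} (hB : B.IsMinimal)
include hpos hB

/-- An entry from `v j` to some `v l` with `deg l > deg j` has degree at most zero; minimality
excludes degree zero. -/
lemma IsMinimal.d_mem_filt {q : ℤ} {m : M.carrier} (hm : m ∈ B.filt q) : M.d m ∈ B.filt q := by
  rw [mem_filt] at hm ⊢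
  refine fun l hl => B.coord_d_eq_zero fun j hj => ?_
  have hjq : B.deg j ≤ q := not_lt.mp fun h => hj (hm j h)
  refine ⟨fun h => by subst h; omega, ?_⟩
  rcases eq_or_ne (B.deg l) (B.deg j + 1) with h | h
  · exact hB l j h
  · exact B.mat_eq_zero_of_lt hpos (by omega)

omit hpos hB in
lemma proj_mem_filt (B : CellBasis M ι) (q : ℤ) (m : M.carrier) :
    B.proj {l | B.deg l = q} m ∈ B.filt q := by
  rw [mem_filt]
  intro l hl
  rw [coord_proj, if_neg]
  exact fun h : B.deg l = q => by omega

omit hpos hB in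
lemma sub_proj_mem_filt {q : ℤ} {m : M.carrier} (hm : m ∈ B.filt q) :
    m - B.proj {l | B.deg l = q} m ∈ B.filt (q - 1) := by
  rw [mem_filt] at hm ⊢
  intro l hl
  rw [map_sub, coord_proj]
  split_ifs with h
  · rw [sub_self]
  · rw [sub_zero]
    have h : B.deg l ≠ q := h
    exact hm l (by omega)

omit hpos hB in
lemma proj_eq_zero_of_mem_filt {q r : ℤ} (hqr : q < r) {m : M.carrier} (hm : m ∈ B.filt q) :
    B.proj {l | B.deg l = r} m = 0 := by
  rw [proj_eq_zero_iff]
  rw [mem_filt] at hm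
  exact fun l (hl : B.deg l = r) => hm l (by omega)

lemma IsMinimal.proj_d {q : ℤ} {m : M.carrier} (hm : m ∈ B.filt q) :
    B.proj {l | B.deg l = q} (M.d (B.proj {l | B.deg l = q} m)) =
      B.proj {l | B.deg l = q} (M.d m) := by
  have := proj_eq_zero_of_mem_filt (r := q) (by omega)
    (hB.d_mem_filt hpos (sub_proj_mem_filt hm))
  rw [map_sub, map_sub, sub_eq_zero] at this
  exact this.symm

lemma IsMinimal.proj_d_proj_d (q : ℤ) (m : M.carrier) :
    B.proj {l | B.deg l = q} (M.d (B.proj {l | B.deg l = q}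
      (M.d (B.proj {l | B.deg l = q} m)))) = 0 := by
  rw [hB.proj_d hpos (hB.d_mem_filt hpos (B.proj_mem_filt q m)), M.d_d, map_zero]

/-- The subquotient of a dg module with minimal basis given by the basis elements of degree `q`. -/
def slice (q : ℤ) : DGModule 𝓐 :=
  M.compress (B.proj {l | B.deg l = q}) (B.proj_proj _) (B.proj_mem _) (hB.proj_d_proj_d hpos q)

/-- The basis of a slice. -/
def sliceBasis (q : ℤ) : CellBasis (slice hpos hB q) {l | B.deg l = q} :=
  B.compress (B.proj {l | B.deg l = q}) (B.proj_proj _) (B.proj_mem _) (hB.proj_d_proj_d hpos q) _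
    (fun l hl => Or.inr (by rw [proj_v, if_neg hl]))
    (fun l hl => by rw [proj_v, if_pos hl, coord_self])
    (fun l _ j hj hlj => by rw [proj_v, if_pos hj, B.coord_ne _ _ hlj])
    (fun l hl j hj hjl h => by rw [coord_proj, if_pos hl, proj_v, if_pos hj, B.triangular l j hjl h])

lemma sliceBasis_deg (q : ℤ) (l) : (sliceBasis hpos hB q).deg l = q := l.2

/-- The inclusion of a slice in the ambient module. -/
def sliceIncl (q : ℤ) : (slice hpos hB q).carrier →ₗ[Aᵐᵒᵖ] M.carrier :=
  M.compressIncl (B.proj {l | B.deg l = q}) (B.proj_proj _) (B.proj_mem _)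
    (hB.proj_d_proj_d hpos q)

/-- The projection of the ambient module to a slice. -/
def sliceProj (q : ℤ) : M.carrier →ₗ[Aᵐᵒᵖ] (slice hpos hB q).carrier :=
  M.compressProj (B.proj {l | B.deg l = q}) (B.proj_proj _) (B.proj_mem _)
    (hB.proj_d_proj_d hpos q)

lemma sliceIncl_sliceProj (q : ℤ) (m : M.carrier) :
    sliceIncl hpos hB q (sliceProj hpos hB q m) = B.proj {l | B.deg l = q} m := rfl

lemma sliceIncl_injective (q : ℤ) : Function.Injective (sliceIncl hpos hB q) :=
  M.compressIncl_injective _ _ _ _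

lemma proj_sliceIncl (q : ℤ) (x : (slice hpos hB q).carrier) :
    B.proj {l | B.deg l = q} (sliceIncl hpos hB q x) = sliceIncl hpos hB q x :=
  M.apply_compressIncl _ _ _ _ x

lemma sliceIncl_mem_filt (q : ℤ) (x : (slice hpos hB q).carrier) :
    sliceIncl hpos hB q x ∈ B.filt q := by
  rw [← proj_sliceIncl]
  exact B.proj_mem_filt q _

lemma sliceIncl_mem (q : ℤ) {i : ℤ} {x : (slice hpos hB q).carrier}
    (hx : x ∈ (slice hpos hB q).gr i) : sliceIncl hpos hB q x ∈ M.gr i := hx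

lemma sliceProj_mem (q : ℤ) {i : ℤ} {m : M.carrier} (hm : m ∈ M.gr i) :
    sliceProj hpos hB q m ∈ (slice hpos hB q).gr i := B.proj_mem _ i m hm

lemma sliceIncl_d (q : ℤ) (x : (slice hpos hB q).carrier) :
    sliceIncl hpos hB q ((slice hpos hB q).d x) =
      B.proj {l | B.deg l = q} (M.d (sliceIncl hpos hB q x)) := rfl

/-- A morphism landing in the right step of the filtration lifts to the slice. -/
def toSlice {q : ℤ} (f : N ⟶ M) (hf : ∀ x, Hom.toLin f x ∈ B.filt q) : N ⟶ slice hpos hB q where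
  toLin := sliceProj hpos hB q ∘ₗ Hom.toLin f
  map_mem i x hx := sliceProj_mem hpos hB q (Hom.map_mem f i x hx)
  map_d x := by
    refine sliceIncl_injective hpos hB q ?_
    rw [sliceIncl_d, LinearMap.comp_apply, LinearMap.comp_apply, sliceIncl_sliceProj,
      sliceIncl_sliceProj, hB.proj_d hpos (hf x), Hom.map_d f]

/-- A morphism vanishing on the previous step of the filtration restricts to the slice. -/
def ofSlice {q : ℤ} (f : M ⟶ N) (hf : ∀ x ∈ B.filt (q - 1), Hom.toLin f x = 0) :
    slice hpos hB q ⟶ N where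
  toLin := Hom.toLin f ∘ₗ sliceIncl hpos hB q
  map_mem i x hx := Hom.map_mem f i _ (sliceIncl_mem hpos hB q hx)
  map_d x := by
    rw [LinearMap.comp_apply, LinearMap.comp_apply, ← Hom.map_d f, sliceIncl_d, eq_comm,
      ← sub_eq_zero, ← map_sub]
    exact hf _ (sub_proj_mem_filt (hB.d_mem_filt hpos (sliceIncl_mem_filt hpos hB q x)))

end Slice

end CellBasis

end PerfectDG

namespace PerfectDG

variable {k : Type w} [CommRing k] {A : Type u} [Ring A] [Algebra k A] {𝓐 : DGAlgebra k A}

/-! ### The heart and modules with a finite basis in degree zero. -/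

open DGModule

/-- The linear map `a ↦ m a`. -/
def DGModule.orbit {M : DGModule 𝓐} (m : M.carrier) : A →ₗ[Aᵐᵒᵖ] M.carrier where
  toFun a := op a • m
  map_add' x y := by rw [MulOpposite.op_add, add_smul]
  map_smul' r x := by
    obtain ⟨a, rfl⟩ := op_surjective r
    rw [op_smul_eq_mul, op_mul, mul_smul, RingHom.id_apply]

@[simp] lemma DGModule.orbit_apply {M : DGModule 𝓐} (m : M.carrier) (a : A) :
    orbit m a = op a • m := rfl

namespace CellBasis

variable {M N : DGModule 𝓐} {ι κ : Type} [LinearOrder ι] [Fintype ι] [LinearOrder κ] [Fintype κ]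

lemma exists_forall_lt_deg (B : CellBasis M ι) : ∃ b : ℤ, b ≤ -1 ∧ ∀ l, b < B.deg l := by
  obtain ⟨b, hb⟩ := (Set.finite_range B.deg).bddBelow
  exact ⟨min (b - 1) (-1), min_le_right _ _, fun l => by
    have : b ≤ B.deg l := hb ⟨l, rfl⟩
    omega⟩

lemma exists_forall_deg_le (B : CellBasis M ι) : ∃ b : ℕ, ∀ l, B.deg l ≤ b := by
  obtain ⟨b, hb⟩ := (Set.finite_range B.deg).bddAbove
  exact ⟨b.toNat, fun l => by
    have : B.deg l ≤ b := hb ⟨l, rfl⟩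
    omega⟩

/-- An endomorphism of a dg module with minimal basis which factors up to homotopy through an
object with `H(M̄)` supported in degree zero strictly lowers the filtration in nonzero degrees. -/
lemma IsMinimal.map_mem_filt (hpos : ∀ i : ℤ, i < 0 → 𝓐.gr i = ⊥) {B : CellBasis M ι}
    (hB : B.IsMinimal) {X : DGModule 𝓐} (hX : X.barSupport ⊆ {0}) (r : M ⟶ X) (i : X ⟶ M)
    {q : ℤ} (hq : q ≠ 0) {m : M.carrier} (hm : m ∈ B.filt q) :
    Hom.toLin (r ≫ i) m ∈ B.filt (q - 1) := by
  rw [mem_filt] at hm ⊢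
  intro l hl
  rw [← B.sum_coord m, map_sum, map_sum]
  refine Finset.sum_eq_zero fun j _ => ?_
  by_cases hj : B.coord j m = 0
  · simp [hj]
  have hjq : B.deg j ≤ q := not_lt.mp fun h => hj (hm j h)
  rw [map_smul, map_smul]
  suffices B.coord l (Hom.toLin (r ≫ i) (B.v j)) = 0 by rw [this, smul_zero]
  rcases lt_or_ge (B.deg j) (B.deg l) with h | h
  · exact B.coord_eq_zero_of_lt hpos (Hom.map_mem (r ≫ i) _ _ (B.v_mem j)) h
  · have hlj : B.deg l = B.deg j := by omega
    -- By minimality `r (v j)` is a cocycle in `X̄`, of degree `q ≠ 0`, hence a boundary modulo `X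
    -- A⁺`. Its image under `i` is a boundary modulo `M A⁺`, and boundaries of `M` lie in `M A⁺`,
    -- again by minimality.
    have hj0 : B.deg j ∉ X.barSupport := fun h' => by
      have : B.deg j = 0 := hX h'
      omega
    obtain ⟨x, hx, hx'⟩ := (X.notMem_barSupport_iff _).mp hj0 _ (Hom.map_mem r _ _ (B.v_mem j))
      (by
        rw [← Hom.map_d r]
        exact map_mem_mulAugmentation r (hB.d_mem_mulAugmentation hpos _))
    refine B.coord_eq_zero_of_mem_mulAugmentation hpos
      (by rw [hlj]; exact Hom.map_mem (r ≫ i) _ _ (B.v_mem j)) ?_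
    have h1 := map_mem_mulAugmentation i hx'
    rw [map_sub, Hom.map_d i] at h1
    rw [comp_toLin, ← sub_add_cancel (Hom.toLin i _) (M.d (Hom.toLin i x))]
    exact add_mem h1 (hB.d_mem_mulAugmentation hpos _)

end CellBasis

/-- Objects of the heart are retracts of dg modules with a finite basis in degree zero. -/
lemma exists_cellBasis_deg_zero (hpos : ∀ i : ℤ, i < 0 → 𝓐.gr i = ⊥)
    (hss : IsSemisimpleRing ↥(𝓐.gr 0)) (hd : ∀ a ∈ 𝓐.gr 0, 𝓐.d a = 0) {X : DGHot 𝓐}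
    (hX : perfectSupportedIn 𝓐 {0} X) :
    ∃ (N : DGModule 𝓐) (κ : Type) (_ : LinearOrder κ) (_ : Fintype κ) (C : CellBasis N κ),
      (∀ l, C.deg l = 0) ∧ IsHRetract X.as N := by
  obtain ⟨N₀, κ₀, _, _, B₀, hN₀⟩ := IsPerfect.exists_cellBasis hss hd hX.1
  obtain ⟨N, κ, _, _, B, hN, hB, -⟩ := B₀.exists_isMinimal hpos hd
  obtain ⟨i, r, hir⟩ := hN₀.trans hN
  have step : ∀ q ≠ 0, ∀ m ∈ B.filt q, Hom.toLin (r ≫ i) m ∈ B.filt (q - 1) :=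
    fun q hq m hm => hB.map_mem_filt hpos hX.2 r i hq hm
  -- Composing `i` with `r ≫ i` does not change its homotopy class and lowers the filtration by one,
  -- as long as the current level is positive.
  have hi : ∃ i' : X.as ⟶ N, Homotopic i' i ∧ ∀ x, Hom.toLin i' x ∈ B.filt 0 := by
    obtain ⟨b, hb⟩ := B.exists_forall_deg_le
    suffices ∀ n : ℕ, n ≤ b → ∃ i' : X.as ⟶ N, Homotopic i' i ∧
        ∀ x, Hom.toLin i' x ∈ B.filt ((b : ℤ) - n) by
      simpa using this b le_rfl
    intro n
    induction n with
    | zero =>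
      refine fun _ => ⟨i, Homotopic.refl i, fun x => ?_⟩
      rw [CellBasis.mem_filt]
      intro l hl
      have := hb l
      push_cast at hl
      omega
    | succ n ih =>
      intro hn
      obtain ⟨i', h1, h2⟩ := ih (by omega)
      refine ⟨i' ≫ r ≫ i, ?_, fun x => ?_⟩
      · have := (h1.comp_right (r ≫ i)).trans
          (Homotopic.of_eq (Category.assoc i r i).symm)
        exact this.trans ((hir.comp_right i).trans (Homotopic.of_eq (Category.id_comp i)))
      · have := step _ (by omega) _ (h2 x)
        rwa [show (b : ℤ) - n - 1 = b - (n + 1 : ℕ) by push_cast; ring] at this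
  -- Dually, each composition of `r` with `r ≫ i` on the left makes it vanish on one more step, from
  -- below all degrees up to `-1`.
  have hr : ∃ r' : N ⟶ X.as, Homotopic r' r ∧ ∀ m ∈ B.filt (0 - 1), Hom.toLin r' m = 0 := by
    obtain ⟨b, hb, hb'⟩ := B.exists_forall_lt_deg
    suffices ∀ n : ℕ, b + n ≤ -1 → ∃ r' : N ⟶ X.as, Homotopic r' r ∧
        ∀ m ∈ B.filt (b + n), Hom.toLin r' m = 0 by
      have := this (-1 - b).toNat (by omega)
      rwa [show b + ((-1 - b).toNat : ℤ) = 0 - 1 by omega] at this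
    intro n
    induction n with
    | zero =>
      refine fun _ => ⟨r, Homotopic.refl r, fun m hm => ?_⟩
      rw [CellBasis.mem_filt] at hm
      have : m = 0 := B.ext_coord fun l => by
        rw [map_zero]
        exact hm l (by simpa using hb' l)
      rw [this, map_zero]
    | succ n ih =>
      intro hn
      obtain ⟨r', h1, h2⟩ := ih (by omega)
      refine ⟨(r ≫ i) ≫ r', ?_, fun m hm => ?_⟩
      · have := (h1.comp_left (r ≫ i)).trans (Homotopic.of_eq (Category.assoc r i r))
        exact this.trans ((hir.comp_left r).trans (Homotopic.of_eq (Category.comp_id r)))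
      · have := step _ (by omega) _ hm
        rw [show b + (n + 1 : ℕ) - 1 = b + n by push_cast; ring] at this
        exact h2 _ this
  obtain ⟨i', hi', hi0⟩ := hi
  obtain ⟨r', hr', hr0⟩ := hr
  -- The retraction now passes through the slice of degree zero: projecting `i' x` to it changes `i'
  -- x` by an element of `filt (-1)`, which `r'` kills.
  refine ⟨_, _, _, _, CellBasis.sliceBasis hpos hB 0, CellBasis.sliceBasis_deg hpos hB 0,
    CellBasis.toSlice hpos hB i' hi0, CellBasis.ofSlice hpos hB r' hr0, ?_⟩
  have : CellBasis.toSlice hpos hB i' hi0 ≫ CellBasis.ofSlice hpos hB r' hr0 = i' ≫ r' := by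
    refine hom_ext fun x => ?_
    change Hom.toLin r' (B.proj {l | B.deg l = 0} (Hom.toLin i' x)) = Hom.toLin r' (Hom.toLin i' x)
    rw [eq_comm, ← sub_eq_zero, ← map_sub]
    exact hr0 _ (CellBasis.sub_proj_mem_filt (hi0 x))
  rw [this]
  exact (hi'.comp_right r').trans ((hr'.comp_left i).trans hir)

namespace CellBasis

variable {M N : DGModule 𝓐} {ι κ : Type} [LinearOrder ι] [Fintype ι] [LinearOrder κ] [Fintype κ]

lemma barSupport_subset (hpos : ∀ i : ℤ, i < 0 → 𝓐.gr i = ⊥) (B : CellBasis M ι)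
    (hB : ∀ l, B.deg l = 0) : M.barSupport ⊆ {0} := by
  intro i hi
  by_contra hi0
  have hi0 : i ≠ 0 := hi0
  refine (M.notMem_barSupport_iff i).mpr (fun m hm _ => ⟨0, zero_mem _, ?_⟩) hi
  rw [map_zero, sub_zero, ← B.sum_coord m]
  refine sum_mem fun l _ => ?_
  have ha := B.coord_mem l i m hm
  rcases lt_or_gt_of_ne hi0 with h | h
  · rw [B.coord_eq_zero_of_lt hpos hm (by rw [hB]; exact h)]
    simp
  · exact M.smul_mem_mulAugmentation (B.v_mem l) (by rw [hB]; omega) ha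

/-- The dg module `e 𝓐` for an idempotent `e` in `A⁰`. -/
def idemModule (hd : ∀ a ∈ 𝓐.gr 0, 𝓐.d a = 0) {e : A} (he : 𝓐.IsPrim e) : DGModule 𝓐 :=
  (DGModule.regular 𝓐).compress
    { toFun := fun a => toRegular 𝓐 (e * ofRegular 𝓐 a)
      map_add' := fun x y => by rw [map_add, mul_add, map_add]
      map_smul' := fun r x => by
        obtain ⟨a, rfl⟩ := op_surjective r
        rw [RingHom.id_apply, ← map_smul, map_smul, op_smul_eq_mul, op_smul_eq_mul, mul_assoc] }
    (fun a => by
      change toRegular 𝓐 (e * (e * ofRegular 𝓐 a)) = toRegular 𝓐 (e * ofRegular 𝓐 a)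
      rw [← mul_assoc, he.mul_self])
    (fun i a ha => by
      have := SetLike.mul_mem_graded he.mem ((mem_regular_gr i a).mp ha)
      rwa [zero_add] at this)
    (fun a => by
      change toRegular 𝓐 (e * 𝓐.d (e * 𝓐.d (e * ofRegular 𝓐 a))) = 0
      have hde : ∀ b, 𝓐.d (e * b) = e * 𝓐.d b := fun b => by
        rw [𝓐.d_mul 0 e he.mem, hd e he.mem]; simp
      simp only [hde, 𝓐.d_d, mul_zero, map_zero])

variable (hd : ∀ a ∈ 𝓐.gr 0, 𝓐.d a = 0) {e : A} (he : 𝓐.IsPrim e)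

/-- The inclusion of `e 𝓐` in `A`. -/
def idemIncl : (idemModule hd he).carrier →ₗ[Aᵐᵒᵖ] A := ofRegular 𝓐 ∘ₗ compressIncl _ _ _ _ _

/-- The projection `a ↦ e a` from `A` to `e 𝓐`. -/
def idemProj : A →ₗ[Aᵐᵒᵖ] (idemModule hd he).carrier := compressProj _ _ _ _ _ ∘ₗ toRegular 𝓐

lemma idemIncl_idemProj (a : A) : idemIncl hd he (idemProj hd he a) = e * a := rfl

lemma idemIncl_injective : Function.Injective (idemIncl hd he) :=
  fun _ _ h => compressIncl_injective _ _ _ _ _ h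

lemma mul_idemIncl (x : (idemModule hd he).carrier) :
    e * idemIncl hd he x = idemIncl hd he x := by
  obtain ⟨_, y, rfl⟩ := x
  change e * (e * ofRegular 𝓐 y) = e * ofRegular 𝓐 y
  rw [← mul_assoc, he.mul_self]

lemma idemProj_mem {i : ℤ} {a : A} (ha : a ∈ 𝓐.gr i) :
    idemProj hd he a ∈ (idemModule hd he).gr i := by
  change e * a ∈ 𝓐.gr i
  have := SetLike.mul_mem_graded he.mem ha
  rwa [zero_add] at this

include hd he in
lemma d_idem_mul (b : A) : 𝓐.d (e * b) = e * 𝓐.d b := by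
  rw [𝓐.d_mul 0 e he.mem, hd e he.mem]; simp

lemma idemIncl_d (x : (idemModule hd he).carrier) :
    idemIncl hd he ((idemModule hd he).d x) = 𝓐.d (idemIncl hd he x) := by
  conv_rhs => rw [← mul_idemIncl, d_idem_mul hd he]
  rfl

/-- As `d e = 0`, left multiplication by `e` is a morphism, so `e 𝓐` is a direct summand of `𝓐`
already before passing to homotopy. -/
lemma isPerfect_idemModule : IsPerfect 𝓐 (toHot (idemModule hd he)) := by
  refine IsHRetract.isPerfect (Y := DGModule.regular 𝓐)
    ⟨⟨toRegular 𝓐 ∘ₗ idemIncl hd he, fun i x hx => hx, fun x => ?_⟩,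
      ⟨idemProj hd he ∘ₗ ofRegular 𝓐, fun i x hx => idemProj_mem hd he hx, fun x => ?_⟩,
      Homotopic.of_eq (hom_ext fun x => ?_)⟩ .regular
  · rw [LinearMap.comp_apply, LinearMap.comp_apply, idemIncl_d, d_toRegular]
  · refine idemIncl_injective hd he ?_
    rw [LinearMap.comp_apply, LinearMap.comp_apply, idemIncl_d, idemIncl_idemProj,
      idemIncl_idemProj, d_idem_mul hd he, ofRegular_d]
  · refine idemIncl_injective hd he ?_
    change e * idemIncl hd he x = _
    rw [mul_idemIncl]
    rfl

include hd in
/-- A dg module with a finite basis in degree zero is perfect. -/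
lemma isPerfect (B : CellBasis M ι) (hB : ∀ l, B.deg l = 0) : IsPerfect 𝓐 (toHot M) := by
  classical
  induction hn : Fintype.card ι generalizing ι M with
  | zero =>
    have := Fintype.card_eq_zero_iff.mp hn
    refine IsHRetract.isPerfect (Y := DGModule.regular 𝓐) ⟨zeroHom _ _, zeroHom _ _,
      Homotopic.of_eq (hom_ext fun x => ?_)⟩ .regular
    rw [← B.sum_coord x]
    simp
  | succ n ih =>
    have hne : Nonempty ι := Fintype.card_pos_iff.mp (by omega)
    -- All degrees being equal, triangularity applies to every entry: no `d (v j)` involves the last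
    -- element `v m`. The others span a dg submodule `N`, with quotient `e 𝓐` for the idempotent `e`
    -- of `v m`.
    obtain ⟨m, hm⟩ : ∃ m : ι, ∀ l, l ≤ m :=
      ⟨Finset.univ.max' Finset.univ_nonempty, fun l => Finset.le_max' _ _ (Finset.mem_univ l)⟩
    let s : Set ι := {l | l ≠ m}
    let p := B.proj s
    have hmat : ∀ j, B.mat m j = 0 := fun j => B.triangular m j (hm j) (Or.inl (by rw [hB, hB]))
    have hdp : ∀ x, p (M.d (p x)) = M.d (p x) := fun x => by
      rw [proj_eq_self_iff]
      intro l hl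
      have hl : l = m := by simpa [s] using hl
      subst hl
      refine B.coord_d_eq_zero fun j hj => ⟨?_, hmat j⟩
      rintro rfl
      exact hj (by rw [coord_proj, if_neg (by simp [s])])
    have hdd : ∀ x, p (M.d (p (M.d (p x)))) = 0 := fun x => by
      rw [hdp, hdp, M.d_d]
    let N := M.compress p (B.proj_proj s) (B.proj_mem s) hdd
    let C : CellBasis N s := B.compress p (B.proj_proj s) (B.proj_mem s) hdd s
      (fun l hl => Or.inr (by rw [proj_v, if_neg hl]))
      (fun l hl => by rw [proj_v, if_pos hl, coord_self])
      (fun l _ j hj hlj => by rw [proj_v, if_pos hj, B.coord_ne _ _ hlj])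
      (fun l hl j hj hjl h => by
        rw [coord_proj, if_pos hl, proj_v, if_pos hj, B.triangular l j hjl h])
    have hN : IsPerfect 𝓐 (toHot N) := ih C (fun l => hB l) (by
      have : Fintype.card s = Fintype.card ι - 1 := Set.card_ne_eq m
      omega)
    let incl := M.compressIncl p (B.proj_proj s) (B.proj_mem s) hdd
    let pr := M.compressProj p (B.proj_proj s) (B.proj_mem s) hdd
    have inclpr : ∀ x, incl (pr x) = p x := fun x => rfl
    have dincl : ∀ x, incl (N.d x) = M.d (incl x) := fun x => by
      obtain ⟨_, y, rfl⟩ := x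
      exact hdp y
    have hz : ∀ a : A, p (op a • M.d (B.v m)) = op a • M.d (B.v m) := fun a => by
      rw [proj_eq_self_iff]
      intro l hl
      have hl : l = m := by simpa [s] using hl
      subst hl
      rw [map_smul, ← mat, hmat, smul_zero]
    have hsum : ∀ x, p x + op (B.coord m x) • B.v m = x := fun x => by
      refine B.ext_coord fun l => ?_
      rw [map_add, map_smul, coord_proj]
      by_cases hl : l = m
      · subst hl
        rw [if_neg (by simp [s]), zero_add, coord_self, op_smul_eq_mul, e_mul_coord]
      · rw [if_pos (by simpa [s] using hl), coord_ne _ _ _ hl, smul_zero, add_zero]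
    have hdv : ∀ a : A, M.d (op a • B.v m) = op a • M.d (B.v m) + op (𝓐.d a) • B.v m := fun a => by
      rw [d_smul_v, hB]
      simp
    let P := idemModule hd (B.prim m)
    let ι' := idemIncl hd (B.prim m)
    let π' := idemProj hd (B.prim m)
    have hdι : ∀ y, ι' (P.d y) = 𝓐.d (ι' y) := idemIncl_d hd (B.prim m)
    have hιmem : ∀ i, ∀ y ∈ P.gr i, ι' y ∈ 𝓐.gr i := fun i y hy => hy
    -- The attaching map `a ↦ d (v m) a`. Its cone is `M`; exhibiting `M` as a retract of the cone
    -- is enough.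
    let f : P.shift (-1) ⟶ N :=
      ⟨pr ∘ₗ orbit (M.d (B.v m)) ∘ₗ ι' ∘ₗ P.ofShift (-1), fun i y hy => by
        have h1 := M.smul_mem _ _ _ (M.d_mem _ _ (B.v_mem m)) _
          (hιmem _ _ (P.ofShift_mem rfl hy))
        rw [hB, show (0 : ℤ) + 1 + (i + -1) = i by ring] at h1
        exact M.compressProj_mem _ _ _ _ h1, fun y => by
        refine M.compressIncl_injective _ _ _ hdd ?_
        change incl (pr (op (ι' (P.ofShift (-1) ((P.shift (-1)).d y))) • M.d (B.v m))) =
          incl (N.d (pr (op (ι' (P.ofShift (-1) y)) • M.d (B.v m))))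
        rw [dincl, inclpr, inclpr, hz, hz, ofShift_d, M.d_smul _ _ (M.d_mem _ _ (B.v_mem m)),
          M.d_d, hB]
        simp [hdι]⟩
    have hf : ∀ y, incl (Hom.toLin f y) = op (ι' (P.ofShift (-1) y)) • M.d (B.v m) :=
      fun y => hz _
    refine IsHRetract.isPerfect (Y := DGModule.cone f)
      ⟨⟨coneInl f ∘ₗ pr + coneInr f ∘ₗ P.toShift (-1) ∘ₗ π' ∘ₗ B.coord m, fun i x hx => ?_,
        fun x => ?_⟩,
      ⟨incl ∘ₗ coneFst f + orbit (B.v m) ∘ₗ ι' ∘ₗ P.ofShift (-1) ∘ₗ coneSnd f, fun i x hx => ?_,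
        fun x => ?_⟩, Homotopic.of_eq (hom_ext fun x => ?_)⟩
      (.cone f (.shift _ _ (isPerfect_idemModule hd (B.prim m))) hN)
    · have h1 := B.coord_mem m i x hx
      rw [hB, sub_zero] at h1
      exact add_mem (coneInl_mem f (M.compressProj_mem _ _ _ hdd hx))
        (coneInr_mem f rfl (P.toShift_mem (by ring) (idemProj_mem hd (B.prim m) h1)))
    · refine cone_ext (M.compressIncl_injective _ _ _ hdd ?_) (P.ofShift_injective _
        (idemIncl_injective hd (B.prim m) ?_))
      · change incl (coneFst f (coneInl f (pr (M.d x)) + coneInr f _)) =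
          incl (coneFst f ((DGModule.cone f).d (coneInl f (pr x) +
            coneInr f (P.toShift (-1) (π' (B.coord m x))))))
        rw [map_add, coneFst_coneInl, coneFst_coneInr, add_zero, map_add, d_coneInl, d_coneInr,
          map_add, map_sub, coneFst_coneInl, coneFst_coneInl, coneFst_coneInr, sub_zero, map_add,
          dincl, hf, inclpr, inclpr, ofShift_toShift, idemIncl_idemProj, e_mul_coord]
        conv_lhs => rw [← hsum x, map_add, hdv, map_add, map_add, hz, hdp, map_smul p,
          proj_v, if_neg (by simp [s]), smul_zero, add_zero]
      · change ι' (P.ofShift (-1) (coneSnd f (coneInl f (pr (M.d x)) + coneInr f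
          (P.toShift (-1) (π' (B.coord m (M.d x))))))) =
          ι' (P.ofShift (-1) (coneSnd f ((DGModule.cone f).d (coneInl f (pr x) +
            coneInr f (P.toShift (-1) (π' (B.coord m x)))))))
        have h1 : B.coord m (M.d (p x)) = 0 := by
          rw [← hdp, coord_proj, if_neg (by simp [s])]
        have h2 : B.coord m (M.d x) = 𝓐.d (B.coord m x) := by
          conv_lhs => rw [← hsum x, map_add, hdv, map_add, map_add, h1, map_smul, map_smul, ← mat,
            hmat, coord_self, op_smul_eq_mul, op_smul_eq_mul, zero_mul, zero_add, zero_add,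
            ← d_idem_mul hd (B.prim m), e_mul_coord]
        rw [map_add, coneSnd_coneInl, coneSnd_coneInr, zero_add, map_add, d_coneInl, d_coneInr,
          map_add, map_sub, coneSnd_coneInl, coneSnd_coneInl, coneSnd_coneInr, h2, d_toShift]
        simp [hdι, ι', π', idemIncl_idemProj, e_mul_coord, ← d_idem_mul hd (B.prim m)]
    · have h1 := M.smul_mem _ _ _ (B.v_mem m) _ (hιmem _ _ (P.ofShift_mem rfl hx.2))
      rw [hB, show (0 : ℤ) + (i + 1 + -1) = i by ring] at h1
      exact add_mem (M.compressIncl_mem _ _ _ hdd hx.1) h1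
    · change incl (coneFst f ((DGModule.cone f).d x)) +
          op (ι' (P.ofShift (-1) (coneSnd f ((DGModule.cone f).d x)))) • B.v m =
        M.d (incl (coneFst f x) + op (ι' (P.ofShift (-1) (coneSnd f x))) • B.v m)
      rw [coneFst_d, coneSnd_d, map_add, dincl, hf, map_add, hdv, map_neg, ofShift_d]
      simp [hdι, add_assoc]
    · change incl (coneFst f (coneInl f (pr x) + coneInr f (P.toShift (-1) (π' (B.coord m x))))) +
          op (ι' (P.ofShift (-1) (coneSnd f (coneInl f (pr x) +
            coneInr f (P.toShift (-1) (π' (B.coord m x))))))) • B.v m = x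
      rw [map_add, map_add (coneSnd f), coneFst_coneInl, coneFst_coneInr, coneSnd_coneInl,
        coneSnd_coneInr, add_zero, zero_add, ofShift_toShift, idemIncl_idemProj, e_mul_coord, inclpr, hsum]

end CellBasis

end PerfectDG

namespace PerfectDG

variable {k : Type w} [CommRing k] {A : Type u} [Ring A] [Algebra k A] {𝓐 : DGAlgebra k A}

open DGModule

/-! ### Null-homotopies and obstructions in `H¹`. -/

namespace DGModule

variable {M N P : DGModule 𝓐}

lemma zeroHom_comp (f : N ⟶ P) : zeroHom M N ≫ f = zeroHom M P :=
  hom_ext fun m => by simp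

lemma comp_zeroHom (f : M ⟶ N) : f ≫ zeroHom N P = zeroHom M P :=
  hom_ext fun m => by simp

/-- The composition `cone f ⟶ {1}M ⟶ {1}N` is null-homotopic. -/
lemma coneSndHom_comp_homotopic (f : M ⟶ N) :
    Homotopic (coneSndHom f ≫ shiftMap f 1) (zeroHom _ _) := by
  refine ⟨N.toShift 1 ∘ₗ coneFst f, fun i m hm => N.toShift_mem (by ring) hm.1, fun m => ?_⟩
  simp [d_toShift]

/-- The morphism `{-1}M ⟶ N` corresponding to a morphism `M ⟶ {1}N`. -/
def unshift (f : M ⟶ N.shift 1) : M.shift (-1) ⟶ N where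
  toLin := N.ofShift 1 ∘ₗ Hom.toLin f ∘ₗ M.ofShift (-1)
  map_mem i m hm := N.ofShift_mem (by ring) (Hom.map_mem f _ _ (M.ofShift_mem rfl hm))
  map_d m := by simp [ofShift_d, Hom.map_d f]

/-- Carries null-homotopies between maps into `{1}N`, where cone triangles end, and maps of the
heart, where a monomorphism can be cancelled. -/
lemma homotopic_unshift_iff (f g : M ⟶ N.shift 1) :
    Homotopic (unshift f) (unshift g) ↔ Homotopic f g := by
  constructor
  · rintro ⟨h, h1, h2⟩
    refine ⟨-(N.toShift 1 ∘ₗ h ∘ₗ M.toShift (-1)), fun i m hm => neg_mem (N.toShift_mem ?_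
      (h1 _ _ (M.toShift_mem (j := i + 1) (by ring) hm))), fun m => ?_⟩
    · ring
    · refine N.ofShift_injective 1 ?_
      have := h2 (M.toShift (-1) m)
      simp [unshift, d_toShift] at this
      simp [d_toShift, this]
  · rintro ⟨h, h1, h2⟩
    refine ⟨-(N.ofShift 1 ∘ₗ h ∘ₗ M.ofShift (-1)), fun i m hm => neg_mem (N.ofShift_mem ?_
      (h1 _ _ (M.ofShift_mem rfl hm))), fun m => ?_⟩
    · ring
    · have := congrArg (N.ofShift 1) (h2 (M.ofShift (-1) m))
      simp [ofShift_d] at this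
      simp [unshift, ofShift_d, this]

end DGModule

namespace CellBasis

variable {M N : DGModule 𝓐} {ι κ : Type} [LinearOrder ι] [Fintype ι] [LinearOrder κ] [Fintype κ]

/-- If `H¹(N) = 0`, a morphism to `{1}N` from a dg module with a minimal basis in degrees `-1` and
`0` is null-homotopic provided that it vanishes on the basis elements of degree `-1`. -/
lemma homotopic_zeroHom_of_cohomology (hd : ∀ a ∈ 𝓐.gr 0, 𝓐.d a = 0) {B : CellBasis M ι}
    (hB : B.IsMinimal) (hdeg : ∀ l, B.deg l = 0 ∨ B.deg l = -1)
    (hN : ∀ x ∈ N.gr 1, N.d x = 0 → ∃ y ∈ N.gr (1 - 1), N.d y = x) (φ : M ⟶ N.shift 1)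
    (hφ : ∀ l, B.deg l = -1 → Hom.toLin φ (B.v l) = 0) : Homotopic φ (zeroHom _ _) := by
  classical
  -- Induction over initial segments of the basis: `ψ` is the morphism once it has been made to
  -- vanish on the elements of `s`.
  suffices ∀ s : Finset ι, (∀ l ∈ s, ∀ j < l, j ∈ s) → ∃ ψ : M ⟶ N.shift 1, Homotopic φ ψ ∧
      (∀ l, B.deg l = -1 → Hom.toLin ψ (B.v l) = 0) ∧ ∀ l ∈ s, Hom.toLin ψ (B.v l) = 0 by
    obtain ⟨ψ, h1, -, h2⟩ := this Finset.univ (by simp)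
    have : ψ = zeroHom _ _ := Hom.ext (B.linearMap_ext fun l => h2 l (Finset.mem_univ l))
    exact this ▸ h1
  intro s
  induction s using Finset.induction_on_max with
  | empty => exact fun _ => ⟨φ, Homotopic.refl φ, hφ, by simp⟩
  | insert a s has ih =>
    intro hs
    obtain ⟨ψ, h1, h2, h3⟩ := ih fun l hl j hj =>
      (Finset.mem_insert.mp (hs l (Finset.mem_insert_of_mem hl) j hj)).resolve_left
        (hj.trans (has l hl)).ne
    rcases hdeg a with ha | ha
    swap
    · refine ⟨ψ, h1, h2, fun l hl => ?_⟩
      rcases Finset.mem_insert.mp hl with rfl | hl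
      · exact h2 _ ha
      · exact h3 l hl
    -- `d (v a)` involves only elements of degree `-1` and earlier ones of degree `0`, all killed by
    -- `ψ`. So `ψ (v a)` is a cocycle, of degree one in `N`.
    have hda : (N.shift 1).d (Hom.toLin ψ (B.v a)) = 0 := by
      rw [← Hom.map_d ψ, ← B.sum_mat, map_sum]
      refine Finset.sum_eq_zero fun l _ => ?_
      rw [map_smul]
      rcases hdeg l with hl | hl
      · rcases le_or_gt a l with hal | hla
        · rw [mat, B.triangular l a hal (Or.inl (by rw [hl, ha])), op_zero, zero_smul]
        · rw [h3 l ((Finset.mem_insert.mp (hs a (Finset.mem_insert_self a s) l hla)).resolve_left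
            hla.ne), smul_zero]
      · rw [h2 l hl, smul_zero]
    obtain ⟨y, hy, hdy⟩ := hN (N.ofShift 1 (Hom.toLin ψ (B.v a)))
      (N.ofShift_mem (by rw [ha]; ring) (Hom.map_mem ψ _ _ (B.v_mem a))) (by
        have := congrArg (N.ofShift 1) hda
        simpa [ofShift_d] using this)
    obtain ⟨x, hx, hdx⟩ : ∃ x ∈ (N.shift 1).gr (-1), (N.shift 1).d x = Hom.toLin ψ (B.v a) :=
      -- The sign offsets the differential `-d` of `{1}N`.
      ⟨N.toShift 1 (-y), N.toShift_mem (by ring) (neg_mem hy),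
        N.ofShift_injective 1 (by simp [d_toShift, hdy])⟩
    let H := B.lift (N := N.shift 1) fun l => if l = a then x else 0
    have hH : ∀ m, H m = op (B.coord a m) • x := fun m => by
      simp only [H, lift_apply]
      rw [Finset.sum_eq_single a]
      · rw [if_pos rfl]
      · intro l _ hl
        rw [if_neg hl, smul_zero]
      · simp
    have hHgr : ∀ i, ∀ m ∈ M.gr i, H m ∈ (N.shift 1).gr (i - 1) := fun i m hm => by
      refine B.lift_mem (n := -1) (fun l => ?_) hm
      split_ifs with hl
      · subst hl
        rwa [ha, zero_add]
      · exact zero_mem _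
    -- For `l ≠ a` the correction on `v l` depends only on `mat a l`. This entry vanishes by
    -- minimality if `deg l = -1`, and by triangularity if `l < a`.
    have hzero : ∀ l, l ≠ a → B.mat a l = 0 → Hom.toLin ψ (B.v l) = 0 →
        Hom.toLin (subHom ψ (nullHom H hHgr)) (B.v l) = 0 := fun l hl hm hψ => by
      rw [subHom_apply, nullHom_apply, hψ, hH, hH, B.coord_ne _ _ hl.symm, ← mat, hm]
      simp
    refine ⟨subHom ψ (nullHom H hHgr), h1.trans (homotopic_subHom_nullHom ψ H hHgr),
      fun l hl => ?_, fun l hl => ?_⟩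
    · have hla : l ≠ a := fun h => by
        subst h
        omega
      refine hzero l hla ?_ (h2 l hl)
      exact hB a l (by omega)
    · rcases Finset.mem_insert.mp hl with rfl | hl
      · have h4 := (N.shift 1).d_smul _ _ hx (B.e l)
        rw [hd _ (B.prim l).mem, hdx, ← map_smul, B.smul_v] at h4
        rw [subHom_apply, nullHom_apply, hH, hH, B.coord_self, h4,
          B.triangular l l le_rfl (Or.inl rfl)]
        simp
      · refine hzero l (has l hl).ne ?_ (h3 l hl)
        rcases hdeg l with h | h
        · exact B.triangular a l (has l hl).le (Or.inl (by rw [ha, h]))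
        · exact B.triangular a l (has l hl).le (Or.inr (by rw [ha, h]; ring))

end CellBasis

/-- An object of the heart given by a dg module. -/
abbrev mkHeart (M : DGModule 𝓐) (h : perfectSupportedIn 𝓐 {0} (toHot M)) : Heart 𝓐 := ⟨toHot M, h⟩

/-- A morphism of the heart given by a morphism of dg modules. -/
abbrev heartMap {X Y : Heart 𝓐} (f : X.obj.as ⟶ Y.obj.as) : X ⟶ Y :=
  ObjectProperty.homMk ((Quotient.functor Homotopic).map f)

lemma heartMap_surjective {X Y : Heart 𝓐} (f : X ⟶ Y) : ∃ f₀, heartMap f₀ = f := by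
  obtain ⟨f₀, hf₀⟩ := (Quotient.functor (Homotopic (𝓐 := 𝓐))).map_surjective
    (X := X.obj.as) (Y := Y.obj.as) f.hom
  exact ⟨f₀, ObjectProperty.hom_ext _ hf₀⟩

lemma heartMap_eq_iff {X Y : Heart 𝓐} (f g : X.obj.as ⟶ Y.obj.as) :
    heartMap f = heartMap g ↔ Homotopic f g := by
  rw [← Quotient.functor_map_eq_iff Homotopic]
  exact ⟨fun h => congrArg (fun x => x.hom) h, fun h => ObjectProperty.hom_ext _ h⟩

lemma heartMap_comp {X Y Z : Heart 𝓐} (f : X.obj.as ⟶ Y.obj.as) (g : Y.obj.as ⟶ Z.obj.as) :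
    heartMap (X := X) (Y := Z) (f ≫ g) = heartMap f ≫ heartMap g :=
  ObjectProperty.hom_ext _ ((Quotient.functor Homotopic).map_comp f g)

end PerfectDG

namespace PerfectDG

variable {k : Type w} [CommRing k] {A : Type u} [Ring A] [Algebra k A] {𝓐 : DGAlgebra k A}

/-! ### The two implications. -/

open DGModule

namespace DGModule

variable {M : DGModule 𝓐}

/-- The morphism `{-1}𝓐 ⟶ M` given by a cocycle of degree one. -/
def ofCocycle {z : M.carrier} (hz : z ∈ M.gr 1) (hdz : M.d z = 0) :
    (regular 𝓐).shift (-1) ⟶ M where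
  toLin := orbit z ∘ₗ ofRegular 𝓐 ∘ₗ (regular 𝓐).ofShift (-1)
  map_mem i m hm := by
    have := M.smul_mem _ _ _ hz _
      ((mem_regular_gr _ _).mp ((regular 𝓐).ofShift_mem (n := -1) rfl hm))
    rwa [show 1 + (i + -1) = i by ring] at this
  map_d m := by
    simp [ofShift_d, ofRegular_d, M.d_smul _ _ hz, hdz]

lemma ofCocycle_apply {z : M.carrier} (hz : z ∈ M.gr 1) (hdz : M.d z = 0) (a : A) :
    Hom.toLin (ofCocycle hz hdz) ((regular 𝓐).toShift (-1) (toRegular 𝓐 a)) = op a • z := rfl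

/-- The cone is an extension by `M` of `𝓐` placed in degree zero. In degree `i ≠ 0` the component in
`𝓐` is zero or a multiple of `1` by an element of `A⁺`, which reduces the claim to `M`. -/
lemma barSupport_cone_ofCocycle (hpos : ∀ i : ℤ, i < 0 → 𝓐.gr i = ⊥)
    (hM : M.barSupport ⊆ {0}) {z : M.carrier} (hz : z ∈ M.gr 1) (hdz : M.d z = 0) :
    (cone (ofCocycle hz hdz)).barSupport ⊆ {0} := by
  intro i hi
  by_contra hi0
  have hi0 : i ≠ 0 := hi0
  let f := ofCocycle hz hdz
  refine ((cone f).notMem_barSupport_iff i).mpr (fun x hx hdx => ?_) hi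
  let a : A := ofRegular 𝓐 ((regular 𝓐).ofShift (-1) (coneSnd f x))
  have ha : a ∈ 𝓐.gr i := (mem_regular_gr _ _).mp ((regular 𝓐).ofShift_mem (by ring) hx.2)
  have h1 : coneInr f (coneSnd f x) ∈ (cone f).mulAugmentation := by
    rcases lt_or_gt_of_ne hi0 with h | h
    · rw [hpos i h, Submodule.mem_bot] at ha
      have : coneSnd f x = 0 := ha
      rw [this, map_zero]
      exact zero_mem _
    · have hone : coneInr f ((regular 𝓐).toShift (-1) (toRegular 𝓐 1)) ∈ (cone f).gr 0 :=
        coneInr_mem f rfl ((regular 𝓐).toShift_mem (i := 0) (by ring)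
          ((mem_regular_gr _ _).mpr SetLike.GradedOne.one_mem))
      have := (cone f).smul_mem_mulAugmentation hone h ha
      rwa [← map_smul, ← map_smul, ← map_smul, op_smul_eq_mul, one_mul] at this
  have h2 : coneInl f (M.d (coneFst f x)) ∈ (cone f).mulAugmentation := by
    rw [← d_coneInl]
    have h : (cone f).d (coneInr f (coneSnd f x)) ∈ (cone f).mulAugmentation :=
      (cone f).d_mem_mulAugmentation h1
    rw [← coneInl_add_coneInr f x, map_add] at hdx
    exact (AddSubgroup.add_mem_cancel_right _ h).mp hdx
  have h3 : M.d (coneFst f x) ∈ M.mulAugmentation := by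
    have := linearMap_mem_mulAugmentation (coneFst f) (fun _ _ h => h.1) h2
    rwa [coneFst_coneInl] at this
  obtain ⟨y, hy, hy'⟩ := (M.notMem_barSupport_iff i).mp (fun h => hi0 (hM h)) _ hx.1 h3
  refine ⟨coneInl f y, coneInl_mem f hy, ?_⟩
  have h4 := map_mem_mulAugmentation (coneInlHom f) hy'
  have h5 : x - (cone f).d (coneInl f y) =
      coneInl f (coneFst f x - M.d y) + coneInr f (coneSnd f x) := by
    conv_lhs => rw [← coneInl_add_coneInr f x]
    rw [map_sub, d_coneInl]
    abel
  rw [h5]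
  exact add_mem h4 h1

end DGModule

section

variable (hpos : ∀ i : ℤ, i < 0 → 𝓐.gr i = ⊥) (hss : IsSemisimpleRing ↥(𝓐.gr 0))
  (hd : ∀ a ∈ 𝓐.gr 0, 𝓐.d a = 0)
include hpos hss hd

/-- The inclusion of an object of the heart in an extension by `𝓐` is a monomorphism. -/
lemma mono_coneInlHom_ofCocycle (M : Heart 𝓐) {z : M.obj.as.carrier}
    (hz : z ∈ M.obj.as.gr 1) (hdz : M.obj.as.d z = 0)
    (h : perfectSupportedIn 𝓐 {0} (toHot (cone (ofCocycle hz hdz)))) :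
    Mono (heartMap (X := M) (Y := mkHeart _ h) (coneInlHom (ofCocycle hz hdz))) := by
  refine ⟨fun {Z} u v huv => ?_⟩
  obtain ⟨u, rfl⟩ := heartMap_surjective u
  obtain ⟨v, rfl⟩ := heartMap_surjective v
  rw [← heartMap_comp, ← heartMap_comp, heartMap_eq_iff] at huv
  rw [heartMap_eq_iff]
  obtain ⟨N, κ, _, _, C, hC, i, r, hir⟩ := exists_cellBasis_deg_zero hpos hss hd Z.property
  let f := ofCocycle hz hdz
  have huv : Homotopic (u ≫ coneInlHom f) (v ≫ coneInlHom f) := huv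
  obtain ⟨H, h1, h2⟩ := huv
  -- The homotopy sends generators of degree `0` to degree `-1`, where `𝓐` vanishes; it therefore
  -- takes values in `M`.
  have hzero : coneSnd f ∘ₗ H ∘ₗ Hom.toLin r = 0 := C.linearMap_ext fun l => by
    have h3 := (h1 _ _ (Hom.map_mem r _ _ (C.v_mem l))).2
    have h4 : ofRegular 𝓐 ((regular 𝓐).ofShift (-1) (coneSnd f (H (Hom.toLin r (C.v l))))) ∈
        𝓐.gr (-1) := (mem_regular_gr _ _).mp ((regular 𝓐).ofShift_mem (by rw [hC]; ring) h3)
    rwa [hpos _ (by omega), Submodule.mem_bot] at h4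
  have hzero' : ∀ n, coneSnd f (H (Hom.toLin r n)) = 0 := fun n => LinearMap.congr_fun hzero n
  have key : Homotopic (r ≫ u) (r ≫ v) := by
    refine ⟨coneFst f ∘ₗ H ∘ₗ Hom.toLin r, fun n m hm => (h1 _ _ (Hom.map_mem r _ _ hm)).1,
      fun m => ?_⟩
    have h3 := congrArg (coneFst f) (h2 (Hom.toLin r m))
    rw [comp_toLin, comp_toLin, map_sub, map_add, coneFst_d, hzero', map_zero, add_zero,
      ← Hom.map_d r] at h3
    exact h3
  have h3 := (key.comp_left i)
  rw [← Category.assoc, ← Category.assoc] at h3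
  have h4 : ∀ w : Z.obj.as ⟶ M.obj.as, Homotopic ((i ≫ r) ≫ w) w := fun w =>
    (hir.comp_right w).trans (Homotopic.of_eq (Category.id_comp w))
  exact (h4 u).symm.trans (h3.trans (h4 v))

lemma subsingleton_cohomology_of_injective (M : Heart 𝓐) [Injective M] :
    Subsingleton (M.obj.as.cohomology 1) := by
  rw [subsingleton_gradedCohomology_iff]
  intro z hz hdz
  let f := ofCocycle hz hdz
  have hE : perfectSupportedIn 𝓐 {0} (toHot (cone f)) :=
    ⟨.cone f (.shift _ _ .regular) M.property.1,
      barSupport_cone_ofCocycle hpos M.property.2 hz hdz⟩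
  let j : M ⟶ mkHeart _ hE := heartMap (X := M) (Y := mkHeart _ hE) (coneInlHom f)
  have : Mono j := mono_coneInlHom_ofCocycle hpos hss hd M hz hdz hE
  obtain ⟨ρ, hρ⟩ := heartMap_surjective (Injective.factorThru (𝟙 M) j)
  have h1 : heartMap (X := M) (Y := M) (coneInlHom f ≫ ρ) = heartMap (𝟙 M.obj.as) := by
    refine (heartMap_comp (X := M) (Y := mkHeart _ hE) (Z := M) (coneInlHom f) ρ).trans ?_
    rw [hρ]
    refine (Injective.comp_factorThru (𝟙 M) j).trans (ObjectProperty.hom_ext _ ?_)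
    exact ((Quotient.functor Homotopic).map_id M.obj.as).symm
  obtain ⟨H, h2, h3⟩ := (heartMap_eq_iff _ _).mp h1
  -- `w` is the generator `1` of the copy of `𝓐` in the cone, attached along `z`: `d w = z`.
  let w := coneInr f ((regular 𝓐).toShift (-1) (toRegular 𝓐 1))
  have hw : w ∈ (cone f).gr 0 :=
    coneInr_mem f rfl ((regular 𝓐).toShift_mem (i := 0) (by ring)
      ((mem_regular_gr _ _).mpr SetLike.GradedOne.one_mem))
  have hdw : (cone f).d w = coneInl f z := by
    have h4 : 𝓐.d 1 = 0 := hd 1 SetLike.GradedOne.one_mem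
    simp only [w, d_coneInr, d_toShift, d_toRegular, h4, f, ofCocycle_apply]
    simp
  -- Applying `ρ` to `d w = z` gives `d (ρ w) = ρ z`, while `ρ z - z = d (H z)`.
  refine ⟨Hom.toLin ρ w - H z, ?_, ?_⟩
  · rw [sub_self]
    exact sub_mem (Hom.map_mem ρ _ _ hw) (h2 _ _ hz)
  · have h4 := h3 z
    rw [hdz, map_zero, add_zero, comp_toLin, coneInlHom_apply, id_toLin] at h4
    have h5 : Hom.toLin ρ (coneInl f z) = M.obj.as.d (Hom.toLin ρ w) := hdw ▸ Hom.map_d ρ w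
    rw [map_sub, ← h4, ← h5]
    abel

/-- The obstruction to extending `g` is a map from the cone to `{1}M`. On a minimal model its part
of degree `-1` is removed by the monomorphism, its part of degree `0` by `H¹(M) = 0`. -/
lemma injective_of_subsingleton_cohomology (M : Heart 𝓐)
    (hM : Subsingleton (M.obj.as.cohomology 1)) : Injective M := by
  rw [subsingleton_gradedCohomology_iff] at hM
  refine ⟨fun {X Y} g f _ => ?_⟩
  obtain ⟨g, rfl⟩ := heartMap_surjective g
  obtain ⟨f, rfl⟩ := heartMap_surjective f
  obtain ⟨X', ιX, _, _, BX, hBX, iX, rX, hX⟩ := exists_cellBasis_deg_zero hpos hss hd X.property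
  obtain ⟨Y', ιY, _, _, BY, hBY, iY, rY, hY⟩ := exists_cellBasis_deg_zero hpos hss hd Y.property
  let F := rX ≫ f ≫ iY
  have hF : Homotopic (F ≫ rY) (rX ≫ f) := by
    have := (hY.comp_left (rX ≫ f))
    simpa [F] using this
  obtain ⟨Z, κ, _, _, D, ⟨β, α, hβα⟩, hD, hDdeg⟩ := (BX.cone BY F).exists_isMinimal hpos hd
  have hdeg : ∀ l, D.deg l = 0 ∨ D.deg l = -1 := fun l => by
    obtain ⟨j, hj⟩ := hDdeg l
    rw [hj]
    cases j using Lex.rec with | _ j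
    rcases j with j | j
    · exact Or.inl (hBY j)
    · refine Or.inr ?_
      change BX.deg j - 1 = -1
      rw [hBX]
      ring
  have hfilt : ∀ m ∈ D.filt (-1 - 1), m = 0 := fun m hm => D.ext_coord fun l => by
    rw [map_zero]
    refine (D.mem_filt _ m).mp hm l ?_
    rcases hdeg l with h | h <;> omega
  have hproj : ∀ m ∈ D.filt (-1), D.proj {l | D.deg l = -1} m = m := fun m hm =>
    (sub_eq_zero.mp (hfilt _ (CellBasis.sub_proj_mem_filt hm))).symm
  let θ : Z ⟶ X.obj.as.shift 1 := α ≫ coneSndHom F ≫ shiftMap rX 1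
  -- No basis element has degree below `-1`, so this slice is a dg submodule; `{-1}K₁` lies in the
  -- heart and plays the role of a kernel of `f`.
  let K₁ := CellBasis.slice hpos hD (-1)
  let j : K₁ ⟶ Z := CellBasis.ofSlice hpos hD (𝟙 Z) hfilt
  let BK := (CellBasis.sliceBasis hpos hD (-1)).shift (-1)
  have hBK : ∀ l, BK.deg l = 0 := fun l => by
    change (CellBasis.sliceBasis hpos hD (-1)).deg l - -1 = 0
    rw [CellBasis.sliceBasis_deg]
    ring
  let K : Heart 𝓐 := mkHeart (K₁.shift (-1)) ⟨BK.isPerfect hd hBK, BK.barSupport_subset hpos hBK⟩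
  have hjθf : Homotopic ((j ≫ θ) ≫ shiftMap f 1) (zeroHom _ _) := by
    have h1 : Homotopic (shiftMap rX 1 ≫ shiftMap f 1) (shiftMap F 1 ≫ shiftMap rY 1) :=
      (hF.shiftMap 1).symm
    have h2 := (h1.comp_left (coneSndHom F))
    have h3 := (coneSndHom_comp_homotopic F).comp_right (shiftMap rY 1)
    rw [zeroHom_comp] at h3
    rw [Category.assoc] at h3
    have h4 := ((h2.trans h3).comp_left (j ≫ α))
    rw [comp_zeroHom] at h4
    simpa [θ] using h4
  have hjθ : Homotopic (j ≫ θ) (zeroHom _ _) := by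
    rw [← homotopic_unshift_iff]
    refine (heartMap_eq_iff (X := K) (Y := X) _ _).mp ?_
    rw [← cancel_mono (heartMap f), ← heartMap_comp, ← heartMap_comp, heartMap_eq_iff]
    exact (homotopic_unshift_iff ((j ≫ θ) ≫ shiftMap f 1) (zeroHom _ _ ≫ shiftMap f 1)).mpr
      (by rw [zeroHom_comp]; exact hjθf)
  obtain ⟨H, hH1, hH2⟩ := hjθ
  -- The null-homotopy on `K₁` is extended to `Z` by zero on the generators of degree `0`;
  -- subtracting `d H' + H' d` makes `θ` vanish on those of degree `-1`.
  let H' : Z.carrier →ₗ[Aᵐᵒᵖ] (X.obj.as.shift 1).carrier :=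
    H ∘ₗ CellBasis.sliceProj hpos hD (-1)
  have hH' : ∀ i, ∀ m ∈ Z.gr i, H' m ∈ (X.obj.as.shift 1).gr (i - 1) := fun i m hm =>
    hH1 _ _ (CellBasis.sliceProj_mem hpos hD (-1) hm)
  let θ' := subHom θ (nullHom H' hH')
  have hθ' : ∀ l, D.deg l = -1 → Hom.toLin θ' (D.v l) = 0 := fun l hl => by
    have hv : D.v l ∈ D.filt (-1) := (D.mem_filt _ _).mpr fun m hm =>
      D.coord_ne _ _ fun h => by subst h; omega
    have h1 := hH2 (CellBasis.sliceProj hpos hD (-1) (D.v l))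
    have h2 : Hom.toLin (j ≫ θ) (CellBasis.sliceProj hpos hD (-1) (D.v l)) =
        Hom.toLin θ (D.v l) := congrArg (Hom.toLin θ) (hproj _ hv)
    have h3 : K₁.d (CellBasis.sliceProj hpos hD (-1) (D.v l)) =
        CellBasis.sliceProj hpos hD (-1) (Z.d (D.v l)) :=
      CellBasis.sliceIncl_injective hpos hD (-1) (hD.proj_d hpos hv)
    rw [h2, h3, zeroHom_apply, sub_zero] at h1
    rw [subHom_apply, nullHom_apply, h1]
    exact sub_self _
  have hφ := CellBasis.homotopic_zeroHom_of_cohomology hd hD hdeg hM (θ' ≫ shiftMap g 1)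
    (fun l hl => by rw [comp_toLin, hθ' l hl, map_zero])
  have hcone : Homotopic (coneSndHom F ≫ shiftMap rX 1 ≫ shiftMap g 1) (zeroHom _ _) := by
    have h1 := ((homotopic_subHom_nullHom θ H' hH').comp_right (shiftMap g 1)).trans hφ
    have h2 := h1.comp_left β
    rw [comp_zeroHom] at h2
    have h3 := hβα.comp_right (coneSndHom F ≫ shiftMap rX 1 ≫ shiftMap g 1)
    rw [Category.id_comp] at h3
    refine h3.symm.trans ?_
    simpa [θ] using h2
  -- A null-homotopy on the cone has two components: on `Y'` it is a morphism `h₁ : Y' ⟶ M`, and on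
  -- `X'` it is, up to sign, a homotopy between `rX ≫ g` and `F ≫ h₁`.
  obtain ⟨h, h1, h2⟩ := hcone
  let h₁ : Y' ⟶ M.obj.as :=
    ⟨M.obj.as.ofShift 1 ∘ₗ h ∘ₗ coneInl F, fun i m hm =>
      M.obj.as.ofShift_mem (by ring) (h1 _ _ (coneInl_mem F hm)), fun m => by
      have h3 := congrArg (M.obj.as.ofShift 1) (h2 (coneInl F m))
      simp [ofShift_d] at h3
      rw [eq_comm, neg_add_eq_zero] at h3
      exact h3.symm⟩
  have h₂ : Homotopic (rX ≫ g) (F ≫ h₁) := by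
    refine ⟨-(M.obj.as.ofShift 1 ∘ₗ h ∘ₗ coneInr F), fun i m hm => neg_mem
      (M.obj.as.ofShift_mem (i := i - 1 - 1) (by ring)
        (h1 _ _ (coneInr_mem F (by ring) hm))), fun m => ?_⟩
    have h3 := congrArg (M.obj.as.ofShift 1) (h2 (coneInr F m))
    simp [ofShift_d] at h3
    simp [h₁, h3]
    abel
  refine ⟨heartMap (iY ≫ h₁), ?_⟩
  rw [← heartMap_comp, heartMap_eq_iff]
  have h3 := (h₂.comp_left iX)
  have h4 := hX.comp_right g
  have h5 := hX.comp_right (f ≫ iY ≫ h₁)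
  simp only [F, Category.assoc, Category.id_comp] at h3 h4 h5
  exact h5.symm.trans (h3.symm.trans h4)

end

end PerfectDG

theorem proposition6p6 {k : Type w} [CommRing k] {A : Type u} [Ring A] [Algebra k A]
    (𝓐 : PerfectDG.DGAlgebra k A)
    (hpos : ∀ i : ℤ, i < 0 → 𝓐.gr i = ⊥)
    (hss : IsSemisimpleRing ↥(𝓐.gr 0))
    (hd : ∀ a ∈ 𝓐.gr 0, 𝓐.d a = 0)
    (M : PerfectDG.Heart 𝓐) :
    CategoryTheory.Injective M ↔ Subsingleton (M.obj.as.cohomology 1) :=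
  ⟨fun _ => PerfectDG.subsingleton_cohomology_of_injective hpos hss hd M,
    PerfectDG.injective_of_subsingleton_cohomology hpos hss hd M⟩
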